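/- Let $g:\mathbb R^d\to\mathbb R^{d\times d}$ be a smooth field of symmetric positive definite matrices, $G(x)=g(x)^{-1}$, and $$H(x,y,p,q)=\tfrac12(g(x)q,q)-(G(x)y,p)+\tfrac12\Big(\tfrac{\partial}{\partial x}(G(x)y,y),q\Big),\qquad x,y,p,q\in\mathbb R^d .$$ For a starting point $(x_0,y_0)$ and initial momenta $(p_0,q_0)$ let $(X,Y,P,Q)(t)$ be the solution of Hamilton's equations $\dot x=\partial_pH$, $\dot y=\partial_qH$, $\dot p=-\partial_xH$, $\dot q=-\partial_yH$ with these initial values (the characteristic), and let $J=\det\frac{\partial(X,Y)}{\partial(p_0,q_0)}$. Let $x_0\in\mathbb R^d$, $T>0$ and $b,c,r\in(0,\infty]$. For $0<t<T$ let $Z_t(y_0)$ be the set of all $(p_0,q_0)$ with $t^3|p_0|<c$, $t^2|q_0|<c$ whose characteristic from $(x_0,y_0)$ exists on $[0,t]$. Assume that for all $0<t<T$ and all $y_0$ with $t|y_0|<b$ the map $(p_0,q_0)\mapsto(X,Y)(t)$ is injective on $Z_t(y_0)$ with $J\ne0$ there, and that its image contains the polydisk $\{|x-x_0|<r,\ |y-y_0|<r/t\}$.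 (For $b=c=r=\infty$ this says that the boundary value problem for Hamilton's equations is uniquely and nondegenerately solvable in the whole cotangent bundle.) Then for all real $\rho<r$ and $\beta<b$ with $\rho,\beta\ge0$ there is a constant $K$ such that the following holds for every $y_0$ with $T|y_0|\le\beta$. Let $\Omega$ be the set of all $(t,X(t),Y(t))$ with $0<t<T$ and $(p_0,q_0)\in Z_t(y_0)$ (so $\Omega=(0,T)\times\mathbb R^{2d}$ if $b=c=r=\infty$). Let $S(t,x,y)$ be the two-point function, that is, the action $\int_0^t(P\,\dot X+Q\,\dot Y-H)\,ds$ of the characteristic with momenta in $Z_t(y_0)$ from $(x_0,y_0)$ to $(x,y)$ in time $t$, and let $\phi(t,x,y)$ be real-valued; let $S$ and $\phi$ be $C^2$ on $\Omega$ and satisfy there the Hamilton–Jacobi equation $\partial_tS+H(x,y,\partial_xS,\partial_yS)=0$ and the transport equation $$\partial_t\phi+(g\,\partial_yS,\partial_y\phi)+\tfrac12\phi\,\mathrm{tr}(g\,\partial_y^2S)-(G y,\partial_x\phi)+\tfrac12\Big(\tfrac{\partial}{\partial x}(G y,y),\partial_y\phi\Big)=0 ,$$ and let $t^{2d}\phi(t,x,y)$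 converge to a constant as $(t,x,y)\to(0,x_0,y_0)$ in $\Omega$. Let $C(h)$ be any real function of $h$ and $u^0=C(h)\,\phi\,e^{-S/h}$. Then for every $h>0$ $$\Big[h\tfrac{\partial}{\partial t}-H\big(x,y,-h\tfrac{\partial}{\partial x},-h\tfrac{\partial}{\partial y}\big)\Big]u^0=-\tfrac{h^2}{2}\,C(h)\,\mathrm{tr}\big(g(x)\,\partial_y^2\phi\big)\,e^{-S/h}\quad\text{on }\Omega,$$ where $H(x,y,-h\partial_x,-h\partial_y)u=\frac{h^2}2\mathrm{tr}(g\,\partial_y^2u)+h(Gy,\partial_xu)-\frac h2(\frac{\partial}{\partial x}(Gy,y),\partial_yu)$, and this is a multiplicative error $O(h^2)\,t^2u^0$: $$\Big|\Big[h\tfrac{\partial}{\partial t}-H\big(x,y,-h\tfrac{\partial}{\partial x},-h\tfrac{\partial}{\partial y}\big)\Big]u^0\Big|\le K\,h^2\,t^2\,|u^0|$$ for all $h>0$, $0<t<T$, $|x-x_0|\le\rho$, $|y-y_0|\le\rho/t$. -/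

import Mathlib

open scoped ENNReal InnerProductSpace Topology ContDiff

noncomputable section

namespace WKB

/-- Configuration space `ℝ^d`; both the positions `x` and the fibre variables `y` of the cotangent
bundle live here (local coordinates). -/
abbrev E (d : ℕ) : Type := EuclideanSpace ℝ (Fin d)

/-- Phase space over the cotangent bundle; points are `(x, y, p, q)`, with `p` conjugate to `x` and
`q` conjugate to `y`. -/
abbrev Phase (d : ℕ) : Type := E d × E d × E d × E d

variable {d : ℕ}

/-- A smooth field of symmetric positive definite matrices on `ℝ^d`. -/
structure IsMetric (g : E d → E d →L[ℝ] E d) : Prop where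
  smooth : ContDiff ℝ ∞ g
  symm : ∀ x v w, ⟪g x v, w⟫_ℝ = ⟪v, g x w⟫_ℝ
  pos : ∀ x v, v ≠ 0 → 0 < ⟪g x v, v⟫_ℝ

/-- `G(x) = g(x)⁻¹`. -/
def coG (g : E d → E d →L[ℝ] E d) (x : E d) : E d →L[ℝ] E d := (g x).inverse

/-- The vector `∂/∂x (G(x) y, y)`. -/
def force (g : E d → E d →L[ℝ] E d) (x y : E d) : E d :=
  gradient (fun x' => ⟪coG g x' y, y⟫_ℝ) x

/-- `H(x,y,p,q) = ½ (g(x) q, q) - (G(x) y, p) + ½ (∂/∂x (G(x) y, y), q)`. -/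
def ham (g : E d → E d →L[ℝ] E d) (x y p q : E d) : ℝ :=
  (1 / 2) * ⟪g x q, q⟫_ℝ - ⟪coG g x y, p⟫_ℝ + (1 / 2) * ⟪force g x y, q⟫_ℝ

/-- The Hamiltonian vector field `(∂H/∂p, ∂H/∂q, -∂H/∂x, -∂H/∂y)`. -/
def hamField (g : E d → E d →L[ℝ] E d) (z : Phase d) : Phase d :=
  (gradient (fun p => ham g z.1 z.2.1 p z.2.2.2) z.2.2.1,
   gradient (fun q => ham g z.1 z.2.1 z.2.2.1 q) z.2.2.2,
   -gradient (fun x => ham g x z.2.1 z.2.2.1 z.2.2.2) z.1,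
   -gradient (fun y => ham g z.1 y z.2.2.1 z.2.2.2) z.2.1)

/-- `γ` solves Hamilton's equations on `[0, t]` with `γ 0 = (x₀, y₀, p₀, q₀)`, `ζ = (p₀, q₀)`. -/
structure IsCharacteristic (g : E d → E d →L[ℝ] E d) (t : ℝ) (x₀ y₀ : E d) (ζ : E d × E d)
    (γ : ℝ → Phase d) : Prop where
  init : γ 0 = (x₀, y₀, ζ.1, ζ.2)
  ode : ∀ s ∈ Set.Icc 0 t, HasDerivWithinAt γ (hamField g (γ s)) (Set.Icc 0 t) s

/-- The action `∫₀ᵗ (p dx + q dy - H ds)` along a solution of Hamilton's equations. -/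
def action (g : E d → E d →L[ℝ] E d) (t : ℝ) (γ : ℝ → Phase d) : ℝ :=
  ∫ s in (0 : ℝ)..t,
    (⟪(γ s).2.2.1, (hamField g (γ s)).1⟫_ℝ + ⟪(γ s).2.2.2, (hamField g (γ s)).2.1⟫_ℝ
      - ham g (γ s).1 (γ s).2.1 (γ s).2.2.1 (γ s).2.2.2)

open Classical in
/-- The endpoint map `(p₀, q₀) ↦ (X, Y)(t, x₀, y₀, p₀, q₀)` of the characteristics issuing from
`(x₀, y₀)` (only meaningful where the characteristic exists up to time `t`). -/
def endpoint (g : E d → E d →L[ℝ] E d) (t : ℝ) (x₀ y₀ : E d) (ζ : E d × E d) : E d × E d :=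
  if h : ∃ γ, IsCharacteristic g t x₀ y₀ ζ γ then
    ((Classical.choose h t).1, (Classical.choose h t).2.1)
  else 0

/-- The Jacobian `J = det ∂(X,Y)/∂(p₀,q₀)`. -/
def jac (g : E d → E d →L[ℝ] E d) (t : ℝ) (x₀ y₀ : E d) (ζ : E d × E d) : ℝ :=
  (fderiv ℝ (endpoint g t x₀ y₀) ζ).det

/-- Initial momenta with `t³ |p₀| < c`, `t² |q₀| < c` whose characteristic exists on `[0, t]`.
For `c = ∞` these are all initial momenta of characteristics that exist up to time `t`. -/
def momenta (g : E d → E d →L[ℝ] E d) (c : ℝ≥0∞) (t : ℝ) (x₀ y₀ : E d) : Set (E d × E d) :=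
  {ζ | ENNReal.ofReal (t ^ 3 * ‖ζ.1‖) < c ∧ ENNReal.ofReal (t ^ 2 * ‖ζ.2‖) < c ∧
    ∃ γ, IsCharacteristic g t x₀ y₀ ζ γ}

/-- The open polydisk `B_r(x₀) × B_{r/t}(y₀)`; the whole cotangent bundle for `r = ∞`. -/
def polydisk (r : ℝ≥0∞) (t : ℝ) (x₀ y₀ : E d) : Set (E d × E d) :=
  {z | ENNReal.ofReal ‖z.1 - x₀‖ < r ∧ ENNReal.ofReal (t * ‖z.2 - y₀‖) < r}

/-- Unique nondegenerate solvability of the two-point boundary value problem for Hamilton's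
equations: for `0 < t < T` and every starting point `(x₀, y₀)` with `t |y₀| < b`, each point of the
polydisk of radius `r` is joined to `(x₀, y₀)` in time `t` by a characteristic with initial momenta
in `momenta g c t x₀ y₀`, and on that set the endpoint map is injective with nonzero Jacobian.
For `b = c = r = ∞` this is solvability in the whole cotangent bundle. -/
structure UniquelySolvable (g : E d → E d →L[ℝ] E d) (T : ℝ) (b c r : ℝ≥0∞) (x₀ : E d) :
    Prop where
  inj : ∀ t ∈ Set.Ioo 0 T, ∀ y₀ : E d, ENNReal.ofReal (t * ‖y₀‖) < b →
    Set.InjOn (endpoint g t x₀ y₀) (momenta g c t x₀ y₀)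
  jac_ne : ∀ t ∈ Set.Ioo 0 T, ∀ y₀ : E d, ENNReal.ofReal (t * ‖y₀‖) < b →
    ∀ ζ ∈ momenta g c t x₀ y₀, jac g t x₀ y₀ ζ ≠ 0
  surj : ∀ t ∈ Set.Ioo 0 T, ∀ y₀ : E d, ENNReal.ofReal (t * ‖y₀‖) < b →
    polydisk r t x₀ y₀ ⊆ endpoint g t x₀ y₀ '' momenta g c t x₀ y₀

/-- The set of all `(t, x, y)`, `0 < t < T`, reached by the characteristics from `(x₀, y₀)`;
it is `(0,T) × ℝ^{2d}` if `c = ∞` and the boundary value problem is solvable for all end points. -/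
def reached (g : E d → E d →L[ℝ] E d) (T : ℝ) (c : ℝ≥0∞) (x₀ y₀ : E d) : Set (ℝ × E d × E d) :=
  {z | z.1 ∈ Set.Ioo 0 T ∧ z.2 ∈ endpoint g z.1 x₀ y₀ '' momenta g c z.1 x₀ y₀}

/-- `∂u/∂x`. -/
def gradX (u : ℝ → E d → E d → ℝ) (t : ℝ) (x y : E d) : E d := gradient (fun x' => u t x' y) x

/-- `∂u/∂y`. -/
def gradY (u : ℝ → E d → E d → ℝ) (t : ℝ) (x y : E d) : E d := gradient (fun y' => u t x y') y

/-- `∂u/∂t`. -/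
def derivT (u : ℝ → E d → E d → ℝ) (t : ℝ) (x y : E d) : ℝ := deriv (fun s => u s x y) t

/-- `tr (g(x) ∂²u/∂y²)`. -/
def trHessY (g : E d → E d →L[ℝ] E d) (u : ℝ → E d → E d → ℝ) (t : ℝ) (x y : E d) : ℝ :=
  LinearMap.trace ℝ (E d) ((g x ∘L fderiv ℝ (fun y' => gradY u t x y') y : E d →L[ℝ] E d) :
    E d →ₗ[ℝ] E d)

/-- `H(x, y, -h ∂/∂x, -h ∂/∂y) u`, the derivatives acting first. -/
def hamOp (g : E d → E d →L[ℝ] E d) (h : ℝ) (u : ℝ → E d → E d → ℝ) (t : ℝ) (x y : E d) : ℝ :=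
  h ^ 2 / 2 * trHessY g u t x y + h * ⟪coG g x y, gradX u t x y⟫_ℝ
    - h / 2 * ⟪force g x y, gradY u t x y⟫_ℝ

/-- `[h ∂/∂t - H(x, y, -h ∂/∂x, -h ∂/∂y)] u`. -/
def parabolicOp (g : E d → E d →L[ℝ] E d) (h : ℝ) (u : ℝ → E d → E d → ℝ) (t : ℝ) (x y : E d) :
    ℝ :=
  h * derivT u t x y - hamOp g h u t x y

/-- `S` is the two-point function issuing from `(x₀, y₀)`: its value at a point is the action of the
characteristic from `(x₀, y₀)` to that point. -/
def IsTwoPointFunction (g : E d → E d →L[ℝ] E d) (T : ℝ) (c : ℝ≥0∞) (x₀ y₀ : E d)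
    (S : ℝ → E d → E d → ℝ) : Prop :=
  ∀ t ∈ Set.Ioo 0 T, ∀ ζ ∈ momenta g c t x₀ y₀, ∀ γ, IsCharacteristic g t x₀ y₀ ζ γ →
    S t (γ t).1 (γ t).2.1 = action g t γ

/-- The Hamilton–Jacobi equation `∂S/∂t + H(x, y, ∂S/∂x, ∂S/∂y) = 0` on `Ω`. -/
def HamiltonJacobi (g : E d → E d →L[ℝ] E d) (Ω : Set (ℝ × E d × E d))
    (S : ℝ → E d → E d → ℝ) : Prop :=
  ∀ t x y, (t, x, y) ∈ Ω → derivT S t x y + ham g x y (gradX S t x y) (gradY S t x y) = 0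

/-- The transport equation on `Ω`. -/
def Transport (g : E d → E d →L[ℝ] E d) (Ω : Set (ℝ × E d × E d))
    (S φ : ℝ → E d → E d → ℝ) : Prop :=
  ∀ t x y, (t, x, y) ∈ Ω →
    derivT φ t x y + ⟪g x (gradY S t x y), gradY φ t x y⟫_ℝ
      + (1 / 2) * φ t x y * trHessY g S t x y
      - ⟪coG g x y, gradX φ t x y⟫_ℝ + (1 / 2) * ⟪force g x y, gradY φ t x y⟫_ℝ = 0

/-- The ansatz `u⁰ = C(h) φ exp(-S/h)`. -/
def ansatz (C : ℝ → ℝ) (S φ : ℝ → E d → E d → ℝ) (h : ℝ) (t : ℝ) (x y : E d) : ℝ :=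
  C h * φ t x y * Real.exp (-(S t x y) / h)

end WKB

end

/-!
A characteristic from `(x₀, y₀)` depends smoothly on its initial momenta, since the Picard operator
`γ ↦ z + ∫ V(γ)` is smooth on the space of continuous paths and its derivative is a Volterra
perturbation of the identity. The first variation of the action gives `∂S = (P, Q)` along
characteristics. Hence the endpoint `(X, Y)` moves with a velocity field built from `∂S/∂y`, whose
divergence is `tr (g ∂²S/∂y²)`, and Liouville's formula together with the transport equation shows
that `φ |J|^{1/2}` is constant along characteristics.

The dilation `(t, y, p, q) ↦ (1, t y, t³ p, t² q)` turns the boundary value problem in time `t` into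
the one in time `1` and multiplies `J` by `t^{4d}`. So `t^{2d} φ(t, x, y)` is a constant multiple of
a smooth positive function of `(t y₀, x, t y)`, and `tr (g ∂²φ/∂y²) / φ` is `t²` times a continuous
function of `(t y₀, x, t y)`, which is bounded on compact sets. By the Hamilton–Jacobi and transport
equations this is all that remains of the parabolic operator applied to `φ exp(-S/h)`.
-/

noncomputable section

namespace WKB

/-! ### Smooth dependence of solutions of differential equations on their initial values -/

section Superposition

universe u

variable {X : Type*} [TopologicalSpace X] [CompactSpace X]

section

variable {F F₂ : Type*} [NormedAddCommGroup F] [NormedSpace ℝ F]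
  [NormedAddCommGroup F₂] [NormedSpace ℝ F₂]

/-- Pointwise application `s ↦ A s (h s)` of a continuous family of operators to a continuous map,
as a bounded bilinear map. -/
def pointwiseApply : C(X, F →L[ℝ] F₂) →L[ℝ] C(X, F) →L[ℝ] C(X, F₂) :=
  LinearMap.mkContinuous₂
    (LinearMap.mk₂ ℝ
      (fun (A : C(X, F →L[ℝ] F₂)) (h : C(X, F)) =>
        (⟨fun s => A s (h s), A.continuous.clm_apply h.continuous⟩ : C(X, F₂)))
      (fun _ _ _ => by ext; simp) (fun _ _ _ => by ext; simp)
      (fun _ _ _ => by ext; simp) (fun _ _ _ => by ext; simp)) 1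
    (fun A h => by
      rw [one_mul, ContinuousMap.norm_le _ (by positivity)]
      exact fun s => (A s).le_of_opNorm_le_of_le (A.norm_coe_le_norm s) (h.norm_coe_le_norm s))

@[simp]
theorem pointwiseApply_apply (A : C(X, F →L[ℝ] F₂)) (h : C(X, F)) (s : X) :
    pointwiseApply A h s = A s (h s) := rfl

theorem hasFDerivAt_postcomp {V : F → F₂} {V' : F → F →L[ℝ] F₂} (hc : Continuous V)
    (hc' : Continuous V') (hV : ∀ z, HasFDerivAt V (V' z) z) (γ : C(X, F)) :
    HasFDerivAt (fun γ : C(X, F) => (⟨V, hc⟩ : C(F, F₂)).comp γ)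
      (pointwiseApply ((⟨V', hc'⟩ : C(F, F →L[ℝ] F₂)).comp γ)) γ := by
  rw [hasFDerivAt_iff_isLittleO_nhds_zero, Asymptotics.isLittleO_iff]
  intro ε hε
  have hcont := (ContinuousMap.continuous_postcomp (X := X)
    (⟨V', hc'⟩ : C(F, F →L[ℝ] F₂))).tendsto γ
  obtain ⟨δ, hδ, hball⟩ :=
    Metric.tendsto_nhds_nhds (α := C(X, F)) (β := C(X, F →L[ℝ] F₂)).1 hcont ε hε
  filter_upwards [Metric.ball_mem_nhds (0 : C(X, F)) hδ] with h hh
  rw [mem_ball_zero_iff] at hh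
  rw [ContinuousMap.norm_le _ (by positivity)]
  intro s
  have norm_sub_le : ∀ w ∈ segment ℝ (γ s) (γ s + h s), ‖V' w - V' (γ s)‖ ≤ ε := by
    intro w hw
    rw [segment_eq_image'] at hw
    obtain ⟨θ, hθ, rfl⟩ := hw
    have hdist : dist (γ + θ • h) γ < δ := by
      rw [dist_eq_norm, add_sub_cancel_left, norm_smul, Real.norm_of_nonneg hθ.1]
      exact (mul_le_of_le_one_left (norm_nonneg _) hθ.2).trans_lt hh
    have hle := (ContinuousMap.dist_le hε.le).1 (hball hdist).le s
    rw [dist_eq_norm] at hle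
    simpa using hle
  have hmean := (convex_segment (𝕜 := ℝ) _ _).norm_image_sub_le_of_norm_hasFDerivWithin_le'
    (fun w _ => (hV w).hasFDerivWithinAt) norm_sub_le
    (left_mem_segment ℝ _ _) (right_mem_segment ℝ _ _)
  rw [add_sub_cancel_left] at hmean
  exact hmean.trans (by gcongr; exact h.norm_coe_le_norm s)

end

variable {F : Type u} [NormedAddCommGroup F] [NormedSpace ℝ F]

theorem contDiff_postcomp_nat (n : ℕ) :
    ∀ {F₂ : Type u} [NormedAddCommGroup F₂] [NormedSpace ℝ F₂] (V : C(F, F₂)),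
      ContDiff ℝ n V → ContDiff ℝ n (fun γ : C(X, F) => V.comp γ) := by
  induction n with
  | zero =>
    intro F₂ _ _ V _
    exact contDiff_zero.2 (ContinuousMap.continuous_postcomp V)
  | succ n ih =>
    intro F₂ _ _ V hV
    push_cast at hV ⊢
    obtain ⟨V', hV', hderiv⟩ := contDiff_succ_iff_hasFDerivAt.1 hV
    refine contDiff_succ_iff_hasFDerivAt.2 ⟨_, ?_, hasFDerivAt_postcomp V.continuous
      hV'.continuous hderiv⟩
    exact pointwiseApply.contDiff.comp (ih ⟨V', hV'.continuous⟩ hV')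

theorem contDiff_postcomp {F₂ : Type u} [NormedAddCommGroup F₂] [NormedSpace ℝ F₂] {n : ℕ∞}
    (V : C(F, F₂)) (hV : ContDiff ℝ n V) : ContDiff ℝ n (fun γ : C(X, F) => V.comp γ) :=
  contDiff_iff_forall_nat_le.2 fun m hm =>
    contDiff_postcomp_nat m V (hV.of_le (mod_cast hm))

end Superposition

theorem isUnit_one_sub_of_norm_pow_lt_one {R : Type*} [NormedRing R] [HasSummableGeomSeries R]
    {a : R} {n : ℕ} (h : ‖a ^ n‖ < 1) : IsUnit (1 - a) := by
  have hpow : IsUnit (1 - a ^ n) := isUnit_one_sub_of_norm_lt_one h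
  rw [← mul_neg_geom_sum] at hpow
  refine ((Commute.isUnit_mul_iff ?_).1 hpow).1
  exact Commute.sum_right _ _ _ fun i _ =>
    ((Commute.one_left _).sub_left ((Commute.refl a).pow_right i))

section Volterra

variable {F : Type*} [NormedAddCommGroup F] [NormedSpace ℝ F] {t : ℝ} (ht : 0 ≤ t)

/-- The Volterra operator `f ↦ (s ↦ ∫₀ˢ f)` on continuous curves on `[0, t]`. -/
def volterra : C(Set.Icc 0 t, F) →L[ℝ] C(Set.Icc 0 t, F) :=
  LinearMap.mkContinuous
    { toFun := fun f => ⟨fun s => ∫ r in (0 : ℝ)..s, Set.IccExtend ht f r,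
        (intervalIntegral.continuous_primitive
          (fun _ _ => f.continuous.Icc_extend'.intervalIntegrable _ _) 0).comp
            continuous_subtype_val⟩
      map_add' := fun f g => by
        ext s
        exact intervalIntegral.integral_add (f.continuous.Icc_extend'.intervalIntegrable _ _)
          (g.continuous.Icc_extend'.intervalIntegrable _ _)
      map_smul' := fun c f => by
        ext s
        exact intervalIntegral.integral_smul c _ } t
    (fun f => by
      rw [ContinuousMap.norm_le _ (by positivity)]
      intro s
      refine (intervalIntegral.norm_integral_le_of_norm_le_const (a := 0) (b := s)
        (fun r _ => f.norm_coe_le_norm (Set.projIcc 0 t ht r))).trans ?_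
      rw [sub_zero, abs_of_nonneg s.2.1, mul_comm]
      gcongr
      exact s.2.2)

theorem volterra_apply (f : C(Set.Icc 0 t, F)) (s : Set.Icc 0 t) :
    volterra ht f s = ∫ r in (0 : ℝ)..s, Set.IccExtend ht f r := rfl

theorem norm_volterra_pow_le (A : C(Set.Icc 0 t, F →L[ℝ] F)) (h : C(Set.Icc 0 t, F)) (n : ℕ)
    (s : Set.Icc 0 t) :
    ‖(((volterra ht).comp (pointwiseApply A)) ^ n) h s‖ ≤
      (‖A‖ * s) ^ n / n.factorial * ‖h‖ := by
  induction n generalizing s with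
  | zero => simpa using h.norm_coe_le_norm s
  | succ n ih =>
    rw [pow_succ', mul_apply_eq_comp, ContinuousLinearMap.comp_apply, volterra_apply]
    have norm_integrand_le : ∀ r ∈ Set.Ioc (0 : ℝ) s,
        ‖Set.IccExtend ht (pointwiseApply A
          ((((volterra ht).comp (pointwiseApply A)) ^ n) h)) r‖ ≤
        (‖A‖ ^ (n + 1) / n.factorial * ‖h‖) * r ^ n := by
      intro r hr
      have hr' : r ∈ Set.Icc 0 t := ⟨hr.1.le, hr.2.trans s.2.2⟩
      rw [Set.IccExtend_of_mem ht _ hr', pointwiseApply_apply]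
      refine ((A _).le_of_opNorm_le_of_le (A.norm_coe_le_norm _) (ih ⟨r, hr'⟩)).trans_eq ?_
      ring
    refine (intervalIntegral.norm_integral_le_of_norm_le s.2.1
      (Filter.Eventually.of_forall norm_integrand_le)
      (Continuous.intervalIntegrable (by fun_prop) _ _)).trans_eq ?_
    rw [intervalIntegral.integral_const_mul, integral_pow, Nat.factorial_succ]
    push_cast
    field_simp
    ring

theorem isUnit_one_sub_volterra [CompleteSpace F] (A : C(Set.Icc 0 t, F →L[ℝ] F)) :
    IsUnit (1 - (volterra ht).comp (pointwiseApply A)) := by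
  have hlim := FloorSemiring.tendsto_pow_div_factorial_atTop (‖A‖ * t)
  obtain ⟨n, hn⟩ := (hlim.eventually (gt_mem_nhds one_pos)).exists
  refine isUnit_one_sub_of_norm_pow_lt_one (R := C(Set.Icc 0 t, F) →L[ℝ] C(Set.Icc 0 t, F)) (n := n)
    (lt_of_le_of_lt (ContinuousLinearMap.opNorm_le_bound _ (by positivity) fun h => ?_) hn)
  rw [ContinuousMap.norm_le _ (by positivity)]
  intro s
  refine (norm_volterra_pow_le ht A h n s).trans ?_
  have := s.2.1
  gcongr
  exact s.2.2

theorem eq_const_add_volterra_iff [CompleteSpace F] {c f : C(Set.Icc 0 t, F)} {z : F} :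
    c = ContinuousLinearMap.const ℝ (Set.Icc 0 t) z + volterra ht f ↔
      Set.IccExtend ht c 0 = z ∧
        ∀ s ∈ Set.Icc 0 t,
          HasDerivWithinAt (Set.IccExtend ht c) (Set.IccExtend ht f s) (Set.Icc 0 t) s := by
  have hf : Continuous (Set.IccExtend ht f) := f.continuous.Icc_extend'
  constructor
  · intro hc
    have eq_integral : ∀ s ∈ Set.Icc 0 t,
        Set.IccExtend ht c s = z + ∫ r in (0 : ℝ)..s, Set.IccExtend ht f r := by
      intro s hs
      rw [Set.IccExtend_of_mem ht _ hs, hc]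
      rfl
    refine ⟨by simpa using eq_integral 0 ⟨le_rfl, ht⟩, fun s hs => ?_⟩
    exact ((hf.integral_hasStrictDerivAt 0 s).hasDerivAt.const_add z).hasDerivWithinAt.congr
      eq_integral (eq_integral s hs)
  · rintro ⟨hzero, hderiv⟩
    ext s
    have hFTC := intervalIntegral.integral_eq_sub_of_hasDerivAt_of_le s.2.1
      c.continuous.Icc_extend'.continuousOn
      (fun r hr => (hderiv r ⟨hr.1.le, hr.2.le.trans s.2.2⟩).hasDerivAt
        (Icc_mem_nhds hr.1 (hr.2.trans_le s.2.2))) (hf.intervalIntegrable _ _)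
    rw [hzero, Set.IccExtend_val] at hFTC
    change c s = z + ∫ r in (0 : ℝ)..s, Set.IccExtend ht f r
    rw [hFTC, add_sub_cancel]

end Volterra

section IntegralCurve

variable {F : Type*} [NormedAddCommGroup F] [NormedSpace ℝ F] {V : F → F} {t : ℝ}

theorem eqOn_of_isIntegralCurveOn_Icc (hV : ContDiff ℝ 1 V) {γ₁ γ₂ : ℝ → F} {a b : ℝ}
    (h₁ : IsIntegralCurveOn γ₁ (fun _ => V) (Set.Icc a b))
    (h₂ : IsIntegralCurveOn γ₂ (fun _ => V) (Set.Icc a b)) (ha : γ₁ a = γ₂ a) :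
    Set.EqOn γ₁ γ₂ (Set.Icc a b) := by
  obtain ⟨K, hK⟩ := LocallyLipschitzOn.exists_lipschitzOnWith_of_compact
    ((isCompact_Icc.image_of_continuousOn h₁.continuousOn).union
      (isCompact_Icc.image_of_continuousOn h₂.continuousOn))
    (hV.locallyLipschitz.locallyLipschitzOn)
  have right_deriv : ∀ {γ : ℝ → F}, IsIntegralCurveOn γ (fun _ => V) (Set.Icc a b) →
      ∀ s ∈ Set.Ico a b, HasDerivWithinAt γ (V (γ s)) (Set.Ici s) s := fun h s hs =>
    (h s ⟨hs.1, hs.2.le⟩).mono_of_mem_nhdsWithin (mem_nhdsWithin.2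
      ⟨Set.Iio b, isOpen_Iio, hs.2, fun r hr => ⟨hs.1.trans hr.2, (le_of_lt hr.1)⟩⟩)
  exact ODE_solution_unique_of_mem_Icc_right (v := fun _ => V) (fun _ _ => hK) h₁.continuousOn
    (right_deriv h₁) (fun s hs => Or.inl ⟨s, ⟨hs.1, hs.2.le⟩, rfl⟩) h₂.continuousOn
    (right_deriv h₂) (fun s hs => Or.inr ⟨s, ⟨hs.1, hs.2.le⟩, rfl⟩) ha

theorem eq_picard_iff [CompleteSpace F] (ht : 0 ≤ t) (hV : Continuous V)
    {c : C(Set.Icc 0 t, F)} {z : F} :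
    c = ContinuousLinearMap.const ℝ (Set.Icc 0 t) z + volterra ht ((⟨V, hV⟩ : C(F, F)).comp c) ↔
      Set.IccExtend ht c 0 = z ∧
        IsIntegralCurveOn (Set.IccExtend ht c) (fun _ => V) (Set.Icc 0 t) :=
  eq_const_add_volterra_iff ht

end IntegralCurve

section Flow

variable {F : Type*} [NormedAddCommGroup F] [NormedSpace ℝ F] {V : F → F} {t : ℝ}
  {n : WithTop ℕ∞} {z₀ : F}

/-- A flow of `V` up to time `t` near `z₀`: a family of integral curves on `[0, t]`, of class `C^n`
in the initial value at `z₀`. The curves are elements of the Banach space `C([0, t], F)`, so that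
the smoothness is uniform in time. -/
structure IsLocalFlow (n : WithTop ℕ∞) (V : F → F) (ht : 0 ≤ t) (z₀ : F)
    (Γ : F → C(Set.Icc 0 t, F)) : Prop where
  contDiffAt : ContDiffAt ℝ n Γ z₀
  eventually_isIntegralCurveOn : ∀ᶠ z in 𝓝 z₀, Set.IccExtend ht (Γ z) 0 = z ∧
    IsIntegralCurveOn (Set.IccExtend ht (Γ z)) (fun _ => V) (Set.Icc 0 t)

/-- The derivative at time `s` of a local flow with respect to the initial value. -/
def variation (ht : 0 ≤ t) (Γ : F → C(Set.Icc 0 t, F)) (z₀ : F) (s : ℝ) : F →L[ℝ] F :=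
  (ContinuousMap.evalCLM ℝ (Set.projIcc 0 t ht s)).comp (fderiv ℝ Γ z₀)

namespace IsLocalFlow

variable {ht : 0 ≤ t} {Γ : F → C(Set.Icc 0 t, F)}

theorem contDiffAt_apply (h : IsLocalFlow n V ht z₀ Γ) (s : ℝ) :
    ContDiffAt ℝ n (fun z => Set.IccExtend ht (Γ z) s) z₀ :=
  ContDiffAt.comp z₀ (ContDiff.contDiffAt (ContinuousLinearMap.contDiff
    (E := C(Set.Icc 0 t, F)) (ContinuousMap.evalCLM ℝ (Set.projIcc 0 t ht s)))) h.contDiffAt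

theorem hasFDerivAt (h : IsLocalFlow n V ht z₀ Γ) (hn : n ≠ 0) :
    HasFDerivAt Γ (fderiv ℝ Γ z₀) z₀ :=
  (h.contDiffAt.differentiableAt hn).hasFDerivAt

theorem hasFDerivAt_apply (h : IsLocalFlow n V ht z₀ Γ) (hn : n ≠ 0) (s : ℝ) :
    HasFDerivAt (fun z => Set.IccExtend ht (Γ z) s) (variation ht Γ z₀ s) z₀ :=
  HasFDerivAt.comp z₀ (ContinuousLinearMap.hasFDerivAt (E := C(Set.Icc 0 t, F))
    (ContinuousMap.evalCLM ℝ (Set.projIcc 0 t ht s))) (h.hasFDerivAt hn)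

theorem hasFDerivAt_integral (h : IsLocalFlow n V ht z₀ Γ) (hn : n ≠ 0) {ℓ : F → ℝ}
    (hℓ : ContDiff ℝ 1 ℓ) :
    ∃ A : F →L[ℝ] ℝ, HasFDerivAt (fun z => ∫ s in (0 : ℝ)..t, ℓ (Set.IccExtend ht (Γ z) s)) A z₀ ∧
      ∀ δ, A δ = ∫ s in (0 : ℝ)..t,
        fderiv ℝ ℓ (Set.IccExtend ht (Γ z₀) s) (variation ht Γ z₀ s δ) := by
  have hN := hasFDerivAt_postcomp hℓ.continuous (hℓ.continuous_fderiv one_ne_zero)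
    (fun z => (hℓ.differentiable one_ne_zero z).hasFDerivAt) (Γ z₀)
  have hderiv : HasFDerivAt (fun z => volterra ht ((⟨ℓ, hℓ.continuous⟩ : C(F, ℝ)).comp (Γ z))
      ⟨t, ht, le_rfl⟩) _ z₀ :=
    HasFDerivAt.comp z₀ (ContinuousLinearMap.hasFDerivAt (E := C(Set.Icc 0 t, ℝ))
        (ContinuousMap.evalCLM ℝ (⟨t, ht, le_rfl⟩ : Set.Icc 0 t)))
      (HasFDerivAt.comp z₀ (ContinuousLinearMap.hasFDerivAt (E := C(Set.Icc 0 t, ℝ))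
        (F := C(Set.Icc 0 t, ℝ)) (volterra ht)) (hN.comp z₀ (h.hasFDerivAt hn)))
  exact ⟨_, hderiv, fun _ => rfl⟩

theorem fderiv_apply_eq [CompleteSpace F] (h : IsLocalFlow n V ht z₀ Γ) (hn : n ≠ 0)
    (hV : ContDiff ℝ 1 V) (δ : F) :
    fderiv ℝ Γ z₀ δ = ContinuousLinearMap.const ℝ (Set.Icc 0 t) δ + volterra ht (pointwiseApply
      ((⟨fderiv ℝ V, hV.continuous_fderiv one_ne_zero⟩ : C(F, F →L[ℝ] F)).comp (Γ z₀))
      (fderiv ℝ Γ z₀ δ)) := by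
  have hN := hasFDerivAt_postcomp hV.continuous (hV.continuous_fderiv one_ne_zero)
    (fun z => (hV.differentiable one_ne_zero z).hasFDerivAt) (Γ z₀)
  have hpicard : Γ =ᶠ[𝓝 z₀] fun z => ContinuousLinearMap.const ℝ (Set.Icc 0 t) z +
      volterra ht ((⟨V, hV.continuous⟩ : C(F, F)).comp (Γ z)) :=
    h.eventually_isIntegralCurveOn.mono fun z hz => (eq_picard_iff ht hV.continuous).2 hz
  have hderiv := HasFDerivAt.add (ContinuousLinearMap.hasFDerivAt (F := C(Set.Icc 0 t, F))
      (ContinuousLinearMap.const ℝ (Set.Icc 0 t)))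
    (HasFDerivAt.comp z₀ (ContinuousLinearMap.hasFDerivAt (E := C(Set.Icc 0 t, F))
      (F := C(Set.Icc 0 t, F)) (volterra ht)) (hN.comp z₀ (h.hasFDerivAt hn)))
  exact DFunLike.congr_fun ((h.hasFDerivAt hn).unique (hderiv.congr_of_eventuallyEq hpicard)) δ

theorem variation_zero [CompleteSpace F] (h : IsLocalFlow n V ht z₀ Γ) (hn : n ≠ 0)
    (hV : ContDiff ℝ 1 V) : variation ht Γ z₀ 0 = ContinuousLinearMap.id ℝ F :=
  ContinuousLinearMap.ext fun δ =>
    ((eq_const_add_volterra_iff ht).1 (h.fderiv_apply_eq hn hV δ)).1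

theorem hasDerivWithinAt_variation [CompleteSpace F] (h : IsLocalFlow n V ht z₀ Γ) (hn : n ≠ 0)
    (hV : ContDiff ℝ 1 V) (δ : F) {s : ℝ} (hs : s ∈ Set.Icc 0 t) :
    HasDerivWithinAt (fun s => variation ht Γ z₀ s δ)
      (fderiv ℝ V (Set.IccExtend ht (Γ z₀) s) (variation ht Γ z₀ s δ)) (Set.Icc 0 t) s :=
  ((eq_const_add_volterra_iff ht).1 (h.fderiv_apply_eq hn hV δ)).2 s hs

end IsLocalFlow

end Flow

/-- The Picard equation `c - ∫₀ˢ V(c) = const z` is solved for `c` by the inverse function theorem: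
its linearization is `1` minus a Volterra operator, hence invertible. -/
theorem exists_isLocalFlow {F : Type*} [NormedAddCommGroup F] [NormedSpace ℝ F] [CompleteSpace F]
    {V : F → F} {t : ℝ} (ht : 0 ≤ t) {n : ℕ∞} (hn : n ≠ 0) (hV : ContDiff ℝ n V) {γ : ℝ → F}
    (hγ : IsIntegralCurveOn γ (fun _ => V) (Set.Icc 0 t)) :
    ∃ Γ, IsLocalFlow n V ht (γ 0) Γ ∧ Set.EqOn (Set.IccExtend ht (Γ (γ 0))) γ (Set.Icc 0 t) := by
  replace hn : (n : WithTop ℕ∞) ≠ 0 := mod_cast hn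
  let c₀ : C(Set.Icc 0 t, F) := ⟨(Set.Icc 0 t).domRestrict γ, hγ.continuousOn.domRestrict⟩
  have hc₀ : Set.EqOn (Set.IccExtend ht c₀) γ (Set.Icc 0 t) := fun s hs =>
    Set.IccExtend_of_mem ht _ hs
  let Φ : C(Set.Icc 0 t, F) → C(Set.Icc 0 t, F) := fun c =>
    c - volterra ht ((⟨V, hV.continuous⟩ : C(F, F)).comp c)
  have hΦ : ContDiffAt ℝ n Φ c₀ := ((contDiff_id (E := C(Set.Icc 0 t, F))).sub
    ((ContinuousLinearMap.contDiff (E := C(Set.Icc 0 t, F)) (F := C(Set.Icc 0 t, F))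
      (volterra ht)).comp (contDiff_postcomp (⟨V, hV.continuous⟩ : C(F, F)) hV))).contDiffAt
  have hΦ₀ : Φ c₀ = ContinuousLinearMap.const ℝ (Set.Icc 0 t) (γ 0) :=
    sub_eq_of_eq_add ((eq_picard_iff ht hV.continuous).2 ⟨hc₀ ⟨le_rfl, ht⟩, fun s hs => by
      rw [hc₀ hs]
      exact (hγ s hs).congr hc₀ (hc₀ hs)⟩)
  let A := (⟨fderiv ℝ V, hV.continuous_fderiv hn⟩ : C(F, F →L[ℝ] F)).comp c₀
  obtain ⟨e, he⟩ := isUnit_one_sub_volterra ht A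
  have hΦ' : HasFDerivAt Φ ((ContinuousLinearEquiv.ofUnit e : _ ≃L[ℝ] _) :
      C(Set.Icc 0 t, F) →L[ℝ] C(Set.Icc 0 t, F)) c₀ := by
    have hderiv : HasFDerivAt Φ (1 - (volterra ht).comp (pointwiseApply A)) c₀ :=
      (hasFDerivAt_id _).sub (HasFDerivAt.comp c₀
        (ContinuousLinearMap.hasFDerivAt (E := C(Set.Icc 0 t, F)) (F := C(Set.Icc 0 t, F))
          (volterra ht)) (hasFDerivAt_postcomp hV.continuous (hV.continuous_fderiv hn)
            (fun z => (hV.differentiable hn z).hasFDerivAt) c₀))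
    rwa [← he] at hderiv
  let Γ := fun z => hΦ.localInverse hΦ' hn (ContinuousLinearMap.const ℝ (Set.Icc 0 t) z)
  have hΓ₀ : Γ (γ 0) = c₀ := by
    simpa only [Γ, hΦ₀] using hΦ.localInverse_apply_image hΦ' hn
  refine ⟨Γ, ⟨?_, ?_⟩, hΓ₀ ▸ hc₀⟩
  · refine ContDiffAt.comp (γ 0) ?_ (ContDiff.contDiffAt (ContinuousLinearMap.contDiff
      (F := C(Set.Icc 0 t, F)) (ContinuousLinearMap.const ℝ (Set.Icc 0 t))))
    rw [← hΦ₀]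
    exact hΦ.to_localInverse hΦ' hn
  · have hright := (hΦ.hasStrictFDerivAt' hΦ' hn).eventually_right_inverse
    rw [hΦ₀] at hright
    filter_upwards [((ContinuousLinearMap.const ℝ (Set.Icc 0 t)).continuous.tendsto
      (γ 0)).eventually hright] with z hz
    exact (eq_picard_iff ht hV.continuous).1 (sub_eq_iff_eq_add.1 hz)

/-! ### Determinants and traces -/

section Determinant

variable {𝕜 : Type*} [NontriviallyNormedField 𝕜] {n : Type*} [Fintype n] [DecidableEq n]

/-- The determinant as a continuous multilinear function of the rows. -/
def detMultilinear (𝕜 n : Type*) [NontriviallyNormedField 𝕜] [Fintype n] [DecidableEq n] :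
    ContinuousMultilinearMap 𝕜 (fun _ : n => n → 𝕜) 𝕜 where
  toMultilinearMap := Matrix.detRowAlternating.toMultilinearMap
  cont := Continuous.matrix_det continuous_id

theorem det_updateRow_eq (M : Matrix n n 𝕜) (i : n) (v : n → 𝕜) :
    (M.updateRow i v).det = ∑ j, v j * M.adjugate j i := by
  rw [← Matrix.cramer_transpose_apply, Matrix.cramer_eq_adjugate_mulVec,
    ← Matrix.adjugate_transpose, Matrix.mulVec_eq_sum]
  simp

theorem hasDerivAt_matrix_det {M : 𝕜 → Matrix n n 𝕜} {M' : Matrix n n 𝕜} {s : 𝕜}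
    (hM : ∀ i j, HasDerivAt (fun r => M r i j) (M' i j) s) :
    HasDerivAt (fun r => (M r).det) (Matrix.trace (M' * (M s).adjugate)) s := by
  have hrows : HasDerivAt (fun r => (M r : n → n → 𝕜)) (M' : n → n → 𝕜) s :=
    hasDerivAt_pi.2 fun i => hasDerivAt_pi.2 fun j => hM i j
  refine (((detMultilinear 𝕜 n).hasFDerivAt (M s)).comp_hasDerivAt s hrows).congr_deriv ?_
  exact ((detMultilinear 𝕜 n).linearDeriv_apply (M s) M').trans
    (Finset.sum_congr rfl fun i _ => det_updateRow_eq (M s) i (M' i))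

theorem hasDerivAt_matrix_det_of_mul {M : 𝕜 → Matrix n n 𝕜} {A : Matrix n n 𝕜} {s : 𝕜}
    (hM : ∀ i j, HasDerivAt (fun r => M r i j) ((A * M s) i j) s) :
    HasDerivAt (fun r => (M r).det) (A.trace * (M s).det) s := by
  refine (hasDerivAt_matrix_det hM).congr_deriv ?_
  rw [Matrix.mul_assoc, Matrix.mul_adjugate, Matrix.mul_smul, Matrix.mul_one, Matrix.trace_smul,
    smul_eq_mul, mul_comm]

variable [CompleteSpace 𝕜] {F : Type*} [NormedAddCommGroup F] [NormedSpace 𝕜 F]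
  [FiniteDimensional 𝕜 F]

theorem contDiff_clm_det {k : WithTop ℕ∞} : ContDiff 𝕜 k (fun M : F →L[𝕜] F => M.det) := by
  let b := Module.finBasis 𝕜 F
  have det_eq : ∀ M : F →L[𝕜] F,
      M.det = detMultilinear 𝕜 (Fin (Module.finrank 𝕜 F))
        (fun i j => b.coord i (M (b j))) := fun M => by
    rw [ContinuousLinearMap.det, ← LinearMap.det_toMatrix b]
    congr 1
    ext i j
    exact LinearMap.toMatrix_apply b b _ i j
  simp only [det_eq]
  refine (detMultilinear 𝕜 (Fin (Module.finrank 𝕜 F))).contDiff.comp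
    (contDiff_pi.2 fun i => contDiff_pi.2 fun j => ?_)
  exact (LinearMap.toContinuousLinearMap (b.coord i)).contDiff.comp
    (contDiff_id.clm_apply contDiff_const)

theorem hasDerivAt_det {M : 𝕜 → F →L[𝕜] F} {A : F →L[𝕜] F} {s : 𝕜}
    (hM : ∀ v, HasDerivAt (fun r => M r v) (A (M s v)) s) :
    HasDerivAt (fun r => (M r).det) (LinearMap.trace 𝕜 F A * (M s).det) s := by
  let b := Module.finBasis 𝕜 F
  simp only [ContinuousLinearMap.det, ← LinearMap.det_toMatrix b,
    LinearMap.trace_eq_matrix_trace 𝕜 b]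
  refine hasDerivAt_matrix_det_of_mul fun i j => ?_
  rw [← LinearMap.toMatrix_comp]
  simp only [LinearMap.toMatrix_apply]
  exact (LinearMap.toContinuousLinearMap (b.coord i)).hasFDerivAt.comp_hasDerivAt s (hM (b j))

end Determinant

theorem trace_prod_eq {R M N : Type*} [CommRing R] [AddCommGroup M] [Module R M] [Module.Free R M]
    [Module.Finite R M] [AddCommGroup N] [Module R N] [Module.Free R N] [Module.Finite R N]
    (A : M × N →ₗ[R] M × N) :
    LinearMap.trace R (M × N) A =
      LinearMap.trace R M (LinearMap.fst R M N ∘ₗ A ∘ₗ LinearMap.inl R M N) +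
      LinearMap.trace R N (LinearMap.snd R M N ∘ₗ A ∘ₗ LinearMap.inr R M N) := by
  have hA : A = (A ∘ₗ LinearMap.inl R M N) ∘ₗ LinearMap.fst R M N +
      (A ∘ₗ LinearMap.inr R M N) ∘ₗ LinearMap.snd R M N := by
    ext v <;> simp [Prod.mk_zero_zero]
  conv_lhs => rw [hA]
  rw [map_add, LinearMap.trace_comp_comm' (A ∘ₗ LinearMap.inl R M N),
    LinearMap.trace_comp_comm' (A ∘ₗ LinearMap.inr R M N)]

/-! ### The Hamiltonian vector field -/

section Gradient

variable {H : Type*} [NormedAddCommGroup H] [InnerProductSpace ℝ H] [CompleteSpace H]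

theorem inner_gradient_comp {F : Type*} [NormedAddCommGroup F] [NormedSpace ℝ F] {f : F → ℝ}
    {j : H → F} {J : H →L[ℝ] F} {a : H} (hf : DifferentiableAt ℝ f (j a))
    (hj : HasFDerivAt j J a) (v : H) :
    ⟪gradient (fun w => f (j w)) a, v⟫_ℝ = fderiv ℝ f (j a) (J v) := by
  rw [inner_gradient_left]
  exact DFunLike.congr_fun (hf.hasFDerivAt.comp a hj).fderiv v

variable {F : Type*} [NormedAddCommGroup F] [NormedSpace ℝ F] {d : ℕ} {n : ℕ∞ω} {f : F → E d}

theorem contDiffAt_of_inner {z : F} (h : ∀ v, ContDiffAt ℝ n (fun z => ⟪f z, v⟫_ℝ) z) :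
    ContDiffAt ℝ n f z := by
  refine contDiffAt_euclidean.2 fun i => ?_
  simpa [EuclideanSpace.inner_single_right] using h (EuclideanSpace.single i 1)

theorem contDiff_of_inner (h : ∀ v, ContDiff ℝ n fun z => ⟪f z, v⟫_ℝ) : ContDiff ℝ n f :=
  contDiff_iff_contDiffAt.2 fun _ => contDiffAt_of_inner fun v => (h v).contDiffAt

end Gradient

section Hamiltonian

variable {d : ℕ} {g : E d → E d →L[ℝ] E d}

theorem IsMetric.exists_equiv (hg : IsMetric g) (x : E d) :
    ∃ e : E d ≃L[ℝ] E d, (e : E d →L[ℝ] E d) = g x := by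
  have hinj : Function.Injective (g x : E d →ₗ[ℝ] E d) := by
    rw [← LinearMap.ker_eq_bot, LinearMap.ker_eq_bot']
    intro v (hv : g x v = 0)
    by_contra hne
    simpa only [hv, inner_zero_left, lt_self_iff_false] using hg.pos x v hne
  exact ⟨(LinearEquiv.ofInjectiveEndo _ hinj).toContinuousLinearEquiv, by ext; rfl⟩

theorem IsMetric.contDiff_coG (hg : IsMetric g) : ContDiff ℝ ∞ (coG g) := by
  rw [contDiff_iff_contDiffAt]
  intro x
  obtain ⟨e, he⟩ := hg.exists_equiv x
  have hinv := contDiffAt_map_inverse (𝕜 := ℝ) (n := ∞) e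
  rw [he] at hinv
  exact hinv.comp x hg.smooth.contDiffAt

theorem IsMetric.g_coG (hg : IsMetric g) (x v : E d) : g x (coG g x v) = v := by
  obtain ⟨e, he⟩ := hg.exists_equiv x
  rw [coG, ← he, ContinuousLinearMap.inverse_equiv]
  exact e.apply_symm_apply v

theorem IsMetric.coG_symm (hg : IsMetric g) (x v w : E d) :
    ⟪coG g x v, w⟫_ℝ = ⟪v, coG g x w⟫_ℝ := by
  conv_lhs => rw [← hg.g_coG x w]
  conv_rhs => rw [← hg.g_coG x v]
  exact (hg.symm x _ _).symm

theorem IsMetric.hasFDerivAt_coG (hg : IsMetric g) (x : E d) :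
    HasFDerivAt (coG g) (fderiv ℝ (coG g) x) x :=
  (hg.contDiff_coG.differentiable (by simp) x).hasFDerivAt

theorem IsMetric.hasFDerivAt_inner_coG (hg : IsMetric g) (x v w : E d) :
    HasFDerivAt (fun x' => ⟪coG g x' v, w⟫_ℝ)
      ((innerSL ℝ w).comp ((fderiv ℝ (coG g) x).flip v)) x := by
  have hv : HasFDerivAt (fun x' => coG g x' v) ((fderiv ℝ (coG g) x).flip v) x :=
    (ContinuousLinearMap.apply ℝ (E d) v).hasFDerivAt.comp x (hg.hasFDerivAt_coG x)
  simp only [fun x' => real_inner_comm w (coG g x' v)]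
  exact (innerSL ℝ w).hasFDerivAt.comp x hv

theorem IsMetric.inner_force (hg : IsMetric g) (x y v : E d) :
    ⟪force g x y, v⟫_ℝ = ⟪fderiv ℝ (coG g) x v y, y⟫_ℝ := by
  rw [force, inner_gradient_left, (hg.hasFDerivAt_inner_coG x y y).fderiv, real_inner_comm]
  rfl

theorem IsMetric.fderiv_coG_symm (hg : IsMetric g) (x u v w : E d) :
    ⟪fderiv ℝ (coG g) x u v, w⟫_ℝ = ⟪v, fderiv ℝ (coG g) x u w⟫_ℝ := by
  have hswap : (fun x' => ⟪coG g x' v, w⟫_ℝ) = fun x' => ⟪coG g x' w, v⟫_ℝ :=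
    funext fun x' => by rw [hg.coG_symm, real_inner_comm]
  have hvw := hg.hasFDerivAt_inner_coG x v w
  rw [hswap] at hvw
  rw [real_inner_comm]
  exact DFunLike.congr_fun (hvw.unique (hg.hasFDerivAt_inner_coG x w v)) u

theorem IsMetric.contDiff_force (hg : IsMetric g) :
    ContDiff ℝ ∞ (fun z : E d × E d => force g z.1 z.2) := by
  refine contDiff_of_inner fun v => ?_
  simp only [hg.inner_force]
  have hG' : ContDiff ℝ ∞ (fun z : E d × E d => fderiv ℝ (coG g) z.1) :=
    (hg.contDiff_coG.fderiv_right (by simp)).comp contDiff_fst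
  exact ((hG'.clm_apply contDiff_const).clm_apply contDiff_snd).inner ℝ contDiff_snd

/-- The Hamiltonian `ham g` as a function on phase space. -/
def hamFun (g : E d → E d →L[ℝ] E d) (z : Phase d) : ℝ := ham g z.1 z.2.1 z.2.2.1 z.2.2.2

theorem IsMetric.contDiff_hamFun (hg : IsMetric g) : ContDiff ℝ ∞ (hamFun g) := by
  have hx : ContDiff ℝ ∞ (fun z : Phase d => z.1) := contDiff_fst
  have hy : ContDiff ℝ ∞ (fun z : Phase d => z.2.1) := contDiff_snd.fst
  have hp : ContDiff ℝ ∞ (fun z : Phase d => z.2.2.1) := contDiff_snd.snd.fst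
  have hq : ContDiff ℝ ∞ (fun z : Phase d => z.2.2.2) := contDiff_snd.snd.snd
  have hforce : ContDiff ℝ ∞ (fun z : Phase d => force g z.1 z.2.1) :=
    ContDiff.comp (g := fun w : E d × E d => force g w.1 w.2) (f := fun z : Phase d => (z.1, z.2.1))
      hg.contDiff_force (hx.prodMk hy)
  have hgq : ContDiff ℝ ∞ (fun z : Phase d => g z.1 z.2.2.2) := (hg.smooth.comp hx).clm_apply hq
  have hGy : ContDiff ℝ ∞ (fun z : Phase d => coG g z.1 z.2.1) :=
    (hg.contDiff_coG.comp hx).clm_apply hy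
  have hkin : ContDiff ℝ ∞ (fun z : Phase d => (1 / 2 : ℝ) * ⟪g z.1 z.2.2.2, z.2.2.2⟫_ℝ) :=
    contDiff_const.mul (hgq.inner ℝ hq)
  have hdrift : ContDiff ℝ ∞ (fun z : Phase d => ⟪coG g z.1 z.2.1, z.2.2.1⟫_ℝ) := hGy.inner ℝ hp
  have hpot : ContDiff ℝ ∞ (fun z : Phase d => (1 / 2 : ℝ) * ⟪force g z.1 z.2.1, z.2.2.2⟫_ℝ) :=
    contDiff_const.mul (hforce.inner ℝ hq)
  exact (hkin.sub hdrift).add hpot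

theorem IsMetric.hasFDerivAt_hamFun (hg : IsMetric g) (z : Phase d) :
    HasFDerivAt (hamFun g) (fderiv ℝ (hamFun g) z) z :=
  (hg.contDiff_hamFun.differentiable (by simp) z).hasFDerivAt

theorem IsMetric.inner_hamField_x (hg : IsMetric g) (z : Phase d) (v : E d) :
    ⟪(hamField g z).1, v⟫_ℝ = fderiv ℝ (hamFun g) z (0, 0, v, 0) := by
  have hj : HasFDerivAt (fun p => ((z.1, z.2.1, p, z.2.2.2) : Phase d))
      (.prod 0 (.prod 0 (.prod (.id ℝ (E d)) 0))) z.2.2.1 :=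
    (hasFDerivAt_const _ _).prodMk ((hasFDerivAt_const _ _).prodMk
      ((hasFDerivAt_id _).prodMk (hasFDerivAt_const _ _)))
  exact inner_gradient_comp (f := hamFun g) (hg.hasFDerivAt_hamFun z).differentiableAt hj v

theorem IsMetric.inner_hamField_y (hg : IsMetric g) (z : Phase d) (v : E d) :
    ⟪(hamField g z).2.1, v⟫_ℝ = fderiv ℝ (hamFun g) z (0, 0, 0, v) := by
  have hj : HasFDerivAt (fun q => ((z.1, z.2.1, z.2.2.1, q) : Phase d))
      (.prod 0 (.prod 0 (.prod 0 (.id ℝ (E d))))) z.2.2.2 :=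
    (hasFDerivAt_const _ _).prodMk ((hasFDerivAt_const _ _).prodMk
      ((hasFDerivAt_const _ _).prodMk (hasFDerivAt_id _)))
  exact inner_gradient_comp (f := hamFun g) (hg.hasFDerivAt_hamFun z).differentiableAt hj v

theorem IsMetric.inner_hamField_p (hg : IsMetric g) (z : Phase d) (v : E d) :
    ⟪(hamField g z).2.2.1, v⟫_ℝ = -fderiv ℝ (hamFun g) z (v, 0, 0, 0) := by
  have hj : HasFDerivAt (fun x => ((x, z.2) : Phase d))
      (.prod (.id ℝ (E d)) 0) z.1 :=
    (hasFDerivAt_id _).prodMk (hasFDerivAt_const _ _)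
  refine (inner_neg_left _ _).trans (congrArg Neg.neg ?_)
  exact inner_gradient_comp (f := hamFun g) (hg.hasFDerivAt_hamFun z).differentiableAt hj v

theorem IsMetric.inner_hamField_q (hg : IsMetric g) (z : Phase d) (v : E d) :
    ⟪(hamField g z).2.2.2, v⟫_ℝ = -fderiv ℝ (hamFun g) z (0, v, 0, 0) := by
  have hj : HasFDerivAt (fun y => ((z.1, y, z.2.2) : Phase d))
      (.prod 0 (.prod (.id ℝ (E d)) 0)) z.2.1 :=
    (hasFDerivAt_const _ _).prodMk ((hasFDerivAt_id _).prodMk (hasFDerivAt_const _ _))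
  refine (inner_neg_left _ _).trans (congrArg Neg.neg ?_)
  exact inner_gradient_comp (f := hamFun g) (hg.hasFDerivAt_hamFun z).differentiableAt hj v

theorem IsMetric.fderiv_hamFun (hg : IsMetric g) (z δ : Phase d) :
    fderiv ℝ (hamFun g) z δ = -⟪(hamField g z).2.2.1, δ.1⟫_ℝ - ⟪(hamField g z).2.2.2, δ.2.1⟫_ℝ
      + ⟪(hamField g z).1, δ.2.2.1⟫_ℝ + ⟪(hamField g z).2.1, δ.2.2.2⟫_ℝ := by
  rw [hg.inner_hamField_x, hg.inner_hamField_y, hg.inner_hamField_p, hg.inner_hamField_q, neg_neg,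
    sub_neg_eq_add, ← map_add, ← map_add, ← map_add]
  simp

theorem IsMetric.contDiff_hamField (hg : IsMetric g) : ContDiff ℝ ∞ (hamField g) := by
  have hH' : ∀ δ : Phase d, ContDiff ℝ ∞ fun z => fderiv ℝ (hamFun g) z δ := fun δ =>
    (hg.contDiff_hamFun.fderiv_right (by simp)).clm_apply contDiff_const
  refine ContDiff.prodMk (f := fun z => (hamField g z).1) (contDiff_of_inner fun v => ?_)
    (ContDiff.prodMk (f := fun z => (hamField g z).2.1) (contDiff_of_inner fun v => ?_)
    (ContDiff.prodMk (f := fun z => (hamField g z).2.2.1) (contDiff_of_inner fun v => ?_)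
      (contDiff_of_inner (f := fun z => (hamField g z).2.2.2) fun v => ?_)))
  · simpa only [hg.inner_hamField_x] using hH' _
  · simpa only [hg.inner_hamField_y] using hH' _
  · simpa only [hg.inner_hamField_p] using (hH' _).neg
  · simpa only [hg.inner_hamField_q] using (hH' _).neg

theorem hamField_fst (z : Phase d) : (hamField g z).1 = -coG g z.1 z.2.1 := by
  refine ext_inner_right ℝ fun v => ?_
  rw [hamField, inner_gradient_left]
  have h : HasFDerivAt (fun p => ham g z.1 z.2.1 p z.2.2.2) _ z.2.2.1 :=
    ((innerSL ℝ (coG g z.1 z.2.1)).hasFDerivAt.const_sub _).add_const _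
  rw [h.fderiv, inner_neg_left]
  rfl

theorem IsMetric.hamField_snd (hg : IsMetric g) (z : Phase d) :
    (hamField g z).2.1 = g z.1 z.2.2.2 + (1 / 2 : ℝ) • force g z.1 z.2.1 := by
  refine ext_inner_right ℝ fun v => ?_
  rw [hamField, inner_gradient_left]
  have h : HasFDerivAt (fun q => ham g z.1 z.2.1 z.2.2.1 q) _ z.2.2.2 :=
    (((((g z.1).hasFDerivAt (x := z.2.2.2)).inner ℝ (hasFDerivAt_id z.2.2.2)).const_mul
      (1 / 2 : ℝ)).sub_const _).add
        ((innerSL ℝ (force g z.1 z.2.1)).hasFDerivAt.const_mul (1 / 2 : ℝ))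
  have hsymm : ⟪g z.1 v, z.2.2.2⟫_ℝ = ⟪g z.1 z.2.2.2, v⟫_ℝ := by
    rw [hg.symm, real_inner_comm]
  rw [h.fderiv, inner_add_left, real_inner_smul_left]
  simp [hsymm]
  ring

/-- The integrand `p ẋ + q ẏ - H` of the action. -/
def lagrangian (g : E d → E d →L[ℝ] E d) (z : Phase d) : ℝ :=
  ⟪z.2.2.1, (hamField g z).1⟫_ℝ + ⟪z.2.2.2, (hamField g z).2.1⟫_ℝ - hamFun g z

theorem IsMetric.contDiff_lagrangian (hg : IsMetric g) : ContDiff ℝ ∞ (lagrangian g) :=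
  ((contDiff_snd.snd.fst.inner ℝ hg.contDiff_hamField.fst).add
    (contDiff_snd.snd.snd.inner ℝ hg.contDiff_hamField.snd.fst)).sub hg.contDiff_hamFun

/-- Along a solution of Hamilton's equations the right-hand side is the time derivative of
`⟪p, δx⟫ + ⟪q, δy⟫`, where `δ` solves the variational equation. -/
theorem IsMetric.fderiv_lagrangian (hg : IsMetric g) (z δ : Phase d) :
    fderiv ℝ (lagrangian g) z δ =
      ⟪(hamField g z).2.2.1, δ.1⟫_ℝ + ⟪z.2.2.1, (fderiv ℝ (hamField g) z δ).1⟫_ℝ +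
      (⟪(hamField g z).2.2.2, δ.2.1⟫_ℝ + ⟪z.2.2.2, (fderiv ℝ (hamField g) z δ).2.1⟫_ℝ) := by
  have hV : HasFDerivAt (hamField g) (fderiv ℝ (hamField g) z) z :=
    (hg.contDiff_hamField.differentiable (by simp) z).hasFDerivAt
  have h : HasFDerivAt (lagrangian g) _ z :=
    ((hasFDerivAt_snd.snd.fst.inner ℝ hV.fst).add (hasFDerivAt_snd.snd.snd.inner ℝ hV.snd.fst)).sub
      (hg.hasFDerivAt_hamFun z)
  rw [h.fderiv]
  simp [hg.fderiv_hamFun z δ, real_inner_comm δ.2.2.1, real_inner_comm δ.2.2.2]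
  ring

end Hamiltonian

/-! ### Characteristics and their dilations -/

section Characteristics

variable {d : ℕ} {g : E d → E d →L[ℝ] E d} {t : ℝ} {x₀ y₀ : E d} {ζ : E d × E d}
  {γ : ℝ → Phase d}

theorem isCharacteristic_iff : IsCharacteristic g t x₀ y₀ ζ γ ↔
    γ 0 = (x₀, y₀, ζ) ∧ IsIntegralCurveOn γ (fun _ => hamField g) (Set.Icc 0 t) :=
  ⟨fun h => ⟨h.init, h.ode⟩, fun h => ⟨h.1, h.2⟩⟩

theorem IsCharacteristic.isIntegralCurveOn (h : IsCharacteristic g t x₀ y₀ ζ γ) :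
    IsIntegralCurveOn γ (fun _ => hamField g) (Set.Icc 0 t) :=
  h.ode

theorem IsCharacteristic.mono (h : IsCharacteristic g t x₀ y₀ ζ γ) {s : ℝ} (hs : s ≤ t) :
    IsCharacteristic g s x₀ y₀ ζ γ :=
  isCharacteristic_iff.2 ⟨h.init, h.isIntegralCurveOn.mono (Set.Icc_subset_Icc_right hs)⟩

theorem IsMetric.eqOn_of_isCharacteristic (hg : IsMetric g) {γ' : ℝ → Phase d}
    (h : IsCharacteristic g t x₀ y₀ ζ γ) (h' : IsCharacteristic g t x₀ y₀ ζ γ') :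
    Set.EqOn γ γ' (Set.Icc 0 t) :=
  eqOn_of_isIntegralCurveOn_Icc (hg.contDiff_hamField.of_le (by simp)) h.isIntegralCurveOn
    h'.isIntegralCurveOn (h.init.trans h'.init.symm)

theorem IsMetric.endpoint_eq (hg : IsMetric g) (ht : 0 ≤ t)
    (h : IsCharacteristic g t x₀ y₀ ζ γ) : endpoint g t x₀ y₀ ζ = ((γ t).1, (γ t).2.1) := by
  have hex : ∃ γ, IsCharacteristic g t x₀ y₀ ζ γ := ⟨γ, h⟩
  rw [endpoint, dif_pos hex,
    hg.eqOn_of_isCharacteristic (Classical.choose_spec hex) h ⟨ht, le_rfl⟩]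

theorem momenta_anti {c : ℝ≥0∞} {s : ℝ} (hs : 0 ≤ s) (hst : s ≤ t) :
    momenta g c t x₀ y₀ ⊆ momenta g c s x₀ y₀ := by
  rintro ζ ⟨hp, hq, γ, hγ⟩
  exact ⟨(ENNReal.ofReal_le_ofReal (by gcongr)).trans_lt hp,
    (ENNReal.ofReal_le_ofReal (by gcongr)).trans_lt hq, γ, hγ.mono hst⟩

theorem IsMetric.exists_isLocalFlow (hg : IsMetric g) (ht : 0 ≤ t)
    (h : IsCharacteristic g t x₀ y₀ ζ γ) :
    ∃ Γ, IsLocalFlow ∞ (hamField g) ht (x₀, y₀, ζ) Γ ∧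
      Set.EqOn (Set.IccExtend ht (Γ (x₀, y₀, ζ))) γ (Set.Icc 0 t) := by
  have hflow := WKB.exists_isLocalFlow ht (by simp) hg.contDiff_hamField h.isIntegralCurveOn
  rwa [h.init] at hflow

theorem IsLocalFlow.eventually_isCharacteristic {n : ℕ∞ω} {ht : 0 ≤ t}
    {Γ : Phase d → C(Set.Icc 0 t, Phase d)}
    (h : IsLocalFlow n (hamField g) ht (x₀, y₀, ζ) Γ) :
    ∀ᶠ w : E d × E d × E d in 𝓝 (y₀, ζ),
      IsCharacteristic g t x₀ w.1 w.2 (Set.IccExtend ht (Γ (x₀, w))) := by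
  have hc : Continuous fun w : E d × E d × E d => ((x₀, w) : Phase d) := by fun_prop
  filter_upwards [(hc.tendsto (y₀, ζ)).eventually h.eventually_isIntegralCurveOn] with w hw
  exact isCharacteristic_iff.2 hw

theorem IsMetric.contDiffAt_endpoint (hg : IsMetric g) (ht : 0 ≤ t)
    (h : IsCharacteristic g t x₀ y₀ ζ γ) :
    ContDiffAt ℝ ∞ (fun w : E d × E d × E d => endpoint g t x₀ w.1 w.2) (y₀, ζ) := by
  obtain ⟨Γ, hΓ, -⟩ := hg.exists_isLocalFlow ht h
  have hflow : ContDiffAt ℝ ∞ (fun w : E d × E d × E d => Set.IccExtend ht (Γ (x₀, w)) t)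
      (y₀, ζ) :=
    ContDiffAt.comp (y₀, ζ) (g := fun z => Set.IccExtend ht (Γ z) t) (hΓ.contDiffAt_apply t)
      (contDiff_const.prodMk contDiff_id).contDiffAt
  refine (hflow.fst.prodMk hflow.snd.fst).congr_of_eventuallyEq ?_
  filter_upwards [hΓ.eventually_isCharacteristic] with w hw
  exact hg.endpoint_eq ht hw

theorem IsMetric.eventually_mem_momenta (hg : IsMetric g) (ht : 0 ≤ t) {c : ℝ≥0∞}
    (h : ζ ∈ momenta g c t x₀ y₀) :
    ∀ᶠ w : E d × E d × E d in 𝓝 (y₀, ζ), w.2 ∈ momenta g c t x₀ w.1 := by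
  obtain ⟨hp, hq, γ, hγ⟩ := h
  obtain ⟨Γ, hΓ, -⟩ := hg.exists_isLocalFlow ht hγ
  have hpc : Continuous fun w : E d × E d × E d => ENNReal.ofReal (t ^ 3 * ‖w.2.1‖) :=
    ENNReal.continuous_ofReal.comp (by fun_prop)
  have hqc : Continuous fun w : E d × E d × E d => ENNReal.ofReal (t ^ 2 * ‖w.2.2‖) :=
    ENNReal.continuous_ofReal.comp (by fun_prop)
  filter_upwards [hΓ.eventually_isCharacteristic,
    (hpc.tendsto (y₀, ζ)).eventually_lt_const hp,
    (hqc.tendsto (y₀, ζ)).eventually_lt_const hq] with w hw hwp hwq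
  exact ⟨hwp, hwq, _, hw⟩

theorem IsMetric.hasFDerivAt_endpoint (hg : IsMetric g) (ht : 0 ≤ t)
    (h : IsCharacteristic g t x₀ y₀ ζ γ) :
    HasFDerivAt (endpoint g t x₀ y₀) (fderiv ℝ (endpoint g t x₀ y₀) ζ) ζ := by
  have hsmooth : ContDiffAt ℝ ∞ (endpoint g t x₀ y₀) ζ :=
    ContDiffAt.comp ζ (g := fun w : E d × E d × E d => endpoint g t x₀ w.1 w.2)
      (hg.contDiffAt_endpoint ht h) (contDiff_const.prodMk contDiff_id).contDiffAt
  exact (hsmooth.differentiableAt (by simp)).hasFDerivAt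

end Characteristics

section Dilation

variable {d : ℕ} {g : E d → E d →L[ℝ] E d} {t : ℝ} {x₀ y₀ : E d} {ζ : E d × E d}
  {γ : ℝ → Phase d}

/-- The dilation `(p, q) ↦ (t³ p, t² q)` of the momenta. -/
def dilMom (t : ℝ) : E d × E d →L[ℝ] E d × E d :=
  (t ^ 3 • ContinuousLinearMap.id ℝ (E d)).prodMap (t ^ 2 • ContinuousLinearMap.id ℝ (E d))

/-- The dilation `(x, y, p, q) ↦ (x, t y, t³ p, t² q)` of phase space. It multiplies the Hamiltonian
by `t⁴` and turns characteristics on `[0, t]` into characteristics on `[0, 1]`. -/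
def dil (t : ℝ) : Phase d →L[ℝ] Phase d :=
  (ContinuousLinearMap.id ℝ (E d)).prodMap ((t • ContinuousLinearMap.id ℝ (E d)).prodMap (dilMom t))

theorem dilMom_apply (t : ℝ) (ζ : E d × E d) : dilMom t ζ = (t ^ 3 • ζ.1, t ^ 2 • ζ.2) := rfl

theorem dil_apply (t : ℝ) (z : Phase d) : dil t z = (z.1, t • z.2.1, dilMom t z.2.2) := rfl

theorem dilMom_dilMom (s t : ℝ) (ζ : E d × E d) : dilMom s (dilMom t ζ) = dilMom (s * t) ζ := by
  simp only [dilMom_apply, smul_smul, mul_pow]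

theorem dilMom_one (ζ : E d × E d) : dilMom 1 ζ = ζ := by
  simp [dilMom_apply]

theorem dilMom_dilMom_inv (ht : t ≠ 0) (ζ : E d × E d) : dilMom t (dilMom t⁻¹ ζ) = ζ := by
  rw [dilMom_dilMom, mul_inv_cancel₀ ht, dilMom_one]

theorem dil_dil_inv (ht : t ≠ 0) (z : Phase d) : dil t (dil t⁻¹ z) = z := by
  simp only [dil_apply, smul_inv_smul₀ ht, dilMom_dilMom_inv ht]

theorem IsMetric.force_smul (hg : IsMetric g) (t : ℝ) (x y : E d) :
    force g x (t • y) = t ^ 2 • force g x y := by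
  refine ext_inner_right ℝ fun v => ?_
  rw [hg.inner_force, real_inner_smul_left, hg.inner_force, map_smul, real_inner_smul_left,
    real_inner_smul_right, ← mul_assoc, sq]

theorem IsMetric.hamFun_dil (hg : IsMetric g) (t : ℝ) (z : Phase d) :
    hamFun g (dil t z) = t ^ 4 * hamFun g z := by
  simp only [hamFun, ham, dil_apply, dilMom_apply, hg.force_smul, map_smul, real_inner_smul_left,
    real_inner_smul_right]
  ring

theorem IsMetric.fderiv_hamFun_dil (hg : IsMetric g) (ht : t ≠ 0) (z δ : Phase d) :
    fderiv ℝ (hamFun g) (dil t z) δ = t ^ 4 * fderiv ℝ (hamFun g) z (dil t⁻¹ δ) := by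
  have hcomp : HasFDerivAt (fun z => hamFun g (dil t z)) _ z :=
    HasFDerivAt.comp z (g := hamFun g) (hg.hasFDerivAt_hamFun (dil t z)) (dil t).hasFDerivAt
  simp only [hg.hamFun_dil] at hcomp
  have heq := DFunLike.congr_fun
    (hcomp.unique ((hg.hasFDerivAt_hamFun z).const_mul (t ^ 4))) (dil t⁻¹ δ)
  rwa [ContinuousLinearMap.comp_apply, dil_dil_inv ht] at heq

theorem IsMetric.hamField_dil (hg : IsMetric g) (ht : t ≠ 0) (z : Phase d) :
    hamField g (dil t z) = t • dil t (hamField g z) := by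
  refine Prod.ext ?_ (Prod.ext ?_ (Prod.ext ?_ ?_)) <;> refine ext_inner_right ℝ fun v => ?_
  · rw [hg.inner_hamField_x, hg.fderiv_hamFun_dil ht, hg.fderiv_hamFun]
    simp only [dil_apply, dilMom_apply, Prod.smul_fst, real_inner_smul_left, real_inner_smul_right,
      smul_zero, inner_zero_right]
    field_simp
    ring
  · rw [hg.inner_hamField_y, hg.fderiv_hamFun_dil ht, hg.fderiv_hamFun]
    simp only [dil_apply, dilMom_apply, Prod.smul_fst, Prod.smul_snd, real_inner_smul_left,
      real_inner_smul_right, smul_zero, inner_zero_right]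
    field_simp
    ring
  · rw [hg.inner_hamField_p, hg.fderiv_hamFun_dil ht, hg.fderiv_hamFun]
    simp only [dil_apply, dilMom_apply, Prod.smul_fst, Prod.smul_snd, real_inner_smul_left,
      smul_zero, inner_zero_right]
    ring
  · rw [hg.inner_hamField_q, hg.fderiv_hamFun_dil ht, hg.fderiv_hamFun]
    simp only [dil_apply, dilMom_apply, Prod.smul_snd, real_inner_smul_left,
      real_inner_smul_right, smul_zero, inner_zero_right]
    field_simp
    ring

theorem IsMetric.isCharacteristic_dil (hg : IsMetric g) {l : ℝ} (hl : 0 < l)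
    (h : IsCharacteristic g t x₀ y₀ ζ γ) :
    IsCharacteristic g (t / l) x₀ (l • y₀) (dilMom l ζ) (fun s => dil l (γ (l * s))) := by
  refine isCharacteristic_iff.2 ⟨by rw [mul_zero, h.init]; rfl, fun s hs => ?_⟩
  have hmaps : Set.MapsTo (fun s => l * s) (Set.Icc 0 (t / l)) (Set.Icc 0 t) := fun r hr =>
    ⟨mul_nonneg hl.le hr.1, (le_div_iff₀' hl).1 hr.2⟩
  have hγ := (h.ode (l * s) (hmaps hs)).scomp s
    (HasDerivAt.hasDerivWithinAt ((hasDerivAt_id s).const_mul l)) hmaps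
  refine ((dil l).hasFDerivAt.comp_hasDerivWithinAt s hγ).congr_deriv ?_
  rw [mul_one, map_smul]
  exact (hg.hamField_dil hl.ne' _).symm

theorem IsMetric.isCharacteristic_dil_self (hg : IsMetric g) (ht : 0 < t)
    (h : IsCharacteristic g t x₀ y₀ ζ γ) :
    IsCharacteristic g 1 x₀ (t • y₀) (dilMom t ζ) (fun s => dil t (γ (t * s))) := by
  simpa only [div_self ht.ne'] using hg.isCharacteristic_dil ht h

theorem IsMetric.exists_isCharacteristic_iff (hg : IsMetric g) (ht : 0 < t) :
    (∃ γ, IsCharacteristic g t x₀ y₀ ζ γ) ↔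
      ∃ γ, IsCharacteristic g 1 x₀ (t • y₀) (dilMom t ζ) γ := by
  refine ⟨fun ⟨γ, h⟩ => ⟨_, hg.isCharacteristic_dil_self ht h⟩, fun ⟨γ, h⟩ => ?_⟩
  have hdil := hg.isCharacteristic_dil (inv_pos.2 ht) h
  rw [one_div, inv_inv, inv_smul_smul₀ ht.ne', dilMom_dilMom, inv_mul_cancel₀ ht.ne',
    dilMom_one] at hdil
  exact ⟨_, hdil⟩

theorem IsMetric.mem_momenta_iff (hg : IsMetric g) (c : ℝ≥0∞) (ht : 0 < t) :
    ζ ∈ momenta g c t x₀ y₀ ↔ dilMom t ζ ∈ momenta g c 1 x₀ (t • y₀) := by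
  simp only [momenta, Set.mem_ofPred_eq, hg.exists_isCharacteristic_iff ht, dilMom_apply, norm_smul,
    norm_pow, Real.norm_of_nonneg ht.le, one_pow, one_mul]

theorem IsMetric.endpoint_dil (hg : IsMetric g) (ht : 0 < t) (x₀ y₀ : E d) (ζ : E d × E d) :
    endpoint g 1 x₀ (t • y₀) (dilMom t ζ) =
      ((endpoint g t x₀ y₀ ζ).1, t • (endpoint g t x₀ y₀ ζ).2) := by
  by_cases hex : ∃ γ, IsCharacteristic g t x₀ y₀ ζ γ
  · obtain ⟨γ, h⟩ := hex
    rw [hg.endpoint_eq ht.le h, hg.endpoint_eq zero_le_one (hg.isCharacteristic_dil_self ht h),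
      mul_one]
    rfl
  · have hex' := mt (hg.exists_isCharacteristic_iff ht).2 hex
    rw [endpoint, endpoint, dif_neg hex, dif_neg hex', Prod.snd_zero, smul_zero]
    rfl

theorem det_prodMap_smul (a b : ℝ) :
    ((a • ContinuousLinearMap.id ℝ (E d)).prodMap
      (b • ContinuousLinearMap.id ℝ (E d))).det = a ^ d * b ^ d := by
  have hlin : (((a • ContinuousLinearMap.id ℝ (E d)).prodMap (b • ContinuousLinearMap.id ℝ (E d)) :
      E d × E d →L[ℝ] E d × E d) : E d × E d →ₗ[ℝ] E d × E d) =
      (a • LinearMap.id).prodMap (b • LinearMap.id) := by ext <;> rfl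
  rw [ContinuousLinearMap.det, hlin, LinearMap.det_prodMap]
  simp

theorem IsMetric.jac_dil (hg : IsMetric g) (ht : 0 < t) (h : IsCharacteristic g t x₀ y₀ ζ γ) :
    jac g t x₀ y₀ ζ = t ^ (4 * d) * jac g 1 x₀ (t • y₀) (dilMom t ζ) := by
  let B : E d × E d →L[ℝ] E d × E d := ((1 : ℝ) • ContinuousLinearMap.id ℝ (E d)).prodMap
    (t • ContinuousLinearMap.id ℝ (E d))
  have hfun : (fun ζ => endpoint g 1 x₀ (t • y₀) (dilMom t ζ)) =
      fun ζ => B (endpoint g t x₀ y₀ ζ) := by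
    funext ζ
    rw [hg.endpoint_dil ht]
    simp [B, Prod.map]
  have hleft : HasFDerivAt (fun ζ => endpoint g 1 x₀ (t • y₀) (dilMom t ζ)) _ ζ :=
    HasFDerivAt.comp ζ (f := dilMom t)
      (hg.hasFDerivAt_endpoint zero_le_one (hg.isCharacteristic_dil_self ht h))
      (dilMom t).hasFDerivAt
  rw [hfun] at hleft
  have hdet := congrArg ContinuousLinearMap.det
    (hleft.unique (B.hasFDerivAt.comp ζ (hg.hasFDerivAt_endpoint ht.le h)))
  have hdetB : B.det = 1 ^ d * t ^ d := det_prodMap_smul 1 t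
  have hdetMom : (dilMom (d := d) t).det = (t ^ 3) ^ d * (t ^ 2) ^ d := det_prodMap_smul _ _
  rw [ContinuousLinearMap.det, ContinuousLinearMap.det] at hdet
  simp only [ContinuousLinearMap.toLinearMap_comp, LinearMap.det_comp] at hdet
  change jac g 1 x₀ (t • y₀) (dilMom t ζ) * (dilMom t).det = B.det * jac g t x₀ y₀ ζ at hdet
  rw [hdetB, hdetMom] at hdet
  refine mul_left_cancel₀ (pow_ne_zero d ht.ne') ?_
  linear_combination -hdet

end Dilation

/-! ### The inverse of the endpoint map -/

section InvFunOn

variable {𝕜 : Type*} [RCLike 𝕜] {F F₂ : Type*} [NormedAddCommGroup F] [NormedSpace 𝕜 F]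
  [CompleteSpace F] [NormedAddCommGroup F₂] [NormedSpace 𝕜 F₂] {n : ℕ∞ω} {f : F → F₂} {M : Set F}

theorem contDiffAt_invFunOn (hn : n ≠ 0) (hM : IsOpen M) (hinj : Set.InjOn f M) {w : F}
    (hw : w ∈ M) (hf : ContDiffAt 𝕜 n f w) {e : F ≃L[𝕜] F₂}
    (he : HasFDerivAt f (e : F →L[𝕜] F₂) w) :
    ContDiffAt 𝕜 n (Function.invFunOn f M) (f w) := by
  have hloc := hf.to_localInverse he hn
  have hmem : ∀ᶠ o in 𝓝 (f w), hf.localInverse he hn o ∈ M :=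
    hloc.continuousAt.eventually (by
      rw [hf.localInverse_apply_image he hn]
      exact hM.mem_nhds hw)
  refine hloc.congr_of_eventuallyEq ?_
  filter_upwards [(hf.hasStrictFDerivAt' he hn).eventually_right_inverse, hmem] with o hright ho
  have hex : ∃ a ∈ M, f a = o := ⟨_, ho, hright⟩
  exact hinj (Function.invFunOn_mem hex) ho ((Function.invFunOn_eq hex).trans hright.symm)

theorem isOpen_image_of_hasFDerivAt_equiv (hn : n ≠ 0) (hM : IsOpen M)
    (hf : ∀ w ∈ M, ContDiffAt 𝕜 n f w)
    (hf' : ∀ w ∈ M, ∃ e : F ≃L[𝕜] F₂, HasFDerivAt f (e : F →L[𝕜] F₂) w) : IsOpen (f '' M) := by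
  refine isOpen_iff_mem_nhds.2 ?_
  rintro _ ⟨w, hw, rfl⟩
  obtain ⟨e, he⟩ := hf' w hw
  rw [← ((hf w hw).hasStrictFDerivAt' he hn).map_nhds_eq_of_equiv]
  exact Filter.image_mem_map (hM.mem_nhds hw)

end InvFunOn

section Endpoint

variable {d : ℕ} {g : E d → E d →L[ℝ] E d} {T t : ℝ} {b c r : ℝ≥0∞} {x₀ y₀ : E d} {ζ : E d × E d}
  {w : E d × E d × E d}

/-- The initial data `(y₀, p₀, q₀)` of the characteristics on `[0, 1]` to which the characteristics
of the boundary value problem are dilated; there `|y₀| < b`. -/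
def unitMomenta (g : E d → E d →L[ℝ] E d) (b c : ℝ≥0∞) (x₀ : E d) : Set (E d × E d × E d) :=
  {w | ENNReal.ofReal ‖w.1‖ < b ∧ w.2 ∈ momenta g c 1 x₀ w.1}

/-- The endpoint map at time `1`. The starting point `y₀` is kept as a component of the value, so
that smoothness of the inverse includes smoothness in `y₀`. -/
def unitEndpoint (g : E d → E d →L[ℝ] E d) (x₀ : E d) (w : E d × E d × E d) :
    E d × E d × E d :=
  (w.1, endpoint g 1 x₀ w.1 w.2)

/-- The starting points and end points `(y₀, x, y)` of the characteristics on `[0, 1]`. -/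
def unitReached (g : E d → E d →L[ℝ] E d) (b c : ℝ≥0∞) (x₀ : E d) : Set (E d × E d × E d) :=
  unitEndpoint g x₀ '' unitMomenta g b c x₀

/-- The initial data `(y₀, p₀, q₀)` of the characteristic on `[0, 1]` from `(x₀, y₀)` to `(x, y)`,
as a function of `(y₀, x, y)`. -/
def unitInverse (g : E d → E d →L[ℝ] E d) (b c : ℝ≥0∞) (x₀ : E d) :
    E d × E d × E d → E d × E d × E d :=
  Function.invFunOn (unitEndpoint g x₀) (unitMomenta g b c x₀)

/-- The Jacobian `J` at time `1` as a function of the initial data `(y₀, p₀, q₀)`. -/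
def unitJac (g : E d → E d →L[ℝ] E d) (x₀ : E d) (w : E d × E d × E d) : ℝ :=
  jac g 1 x₀ w.1 w.2

theorem exists_eq_dil (ht : t ≠ 0) (w : E d × E d × E d) :
    ∃ (y₀ : E d) (ζ : E d × E d), (t • y₀, dilMom t ζ) = w :=
  ⟨t⁻¹ • w.1, dilMom t⁻¹ w.2, by rw [smul_inv_smul₀ ht, dilMom_dilMom_inv ht]⟩

theorem IsMetric.dil_mem_unitMomenta_iff (hg : IsMetric g) (ht : 0 < t) :
    (t • y₀, dilMom t ζ) ∈ unitMomenta g b c x₀ ↔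
      ENNReal.ofReal (t * ‖y₀‖) < b ∧ ζ ∈ momenta g c t x₀ y₀ := by
  rw [hg.mem_momenta_iff c ht, unitMomenta, Set.mem_ofPred_eq, norm_smul, Real.norm_of_nonneg ht.le]

theorem IsMetric.unitEndpoint_dil (hg : IsMetric g) (ht : 0 < t) :
    unitEndpoint g x₀ (t • y₀, dilMom t ζ) =
      (t • y₀, (endpoint g t x₀ y₀ ζ).1, t • (endpoint g t x₀ y₀ ζ).2) := by
  rw [unitEndpoint, hg.endpoint_dil ht]

theorem IsMetric.isOpen_unitMomenta (hg : IsMetric g) : IsOpen (unitMomenta g b c x₀) := by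
  rw [isOpen_iff_mem_nhds]
  rintro ⟨η, ζ⟩ ⟨hη, hζ⟩
  have hcont : Continuous fun w : E d × E d × E d => ENNReal.ofReal ‖w.1‖ :=
    ENNReal.continuous_ofReal.comp (by fun_prop)
  filter_upwards [(hcont.tendsto (η, ζ)).eventually_lt_const hη,
    hg.eventually_mem_momenta zero_le_one hζ] with w hw₁ hw₂
  exact ⟨hw₁, hw₂⟩

theorem IsMetric.contDiffAt_unitEndpoint (hg : IsMetric g) (hw : w ∈ unitMomenta g b c x₀) :
    ContDiffAt ℝ ∞ (unitEndpoint g x₀) w := by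
  obtain ⟨γ, hγ⟩ := hw.2.2.2
  exact contDiffAt_fst.prodMk (hg.contDiffAt_endpoint zero_le_one hγ)

theorem IsMetric.contDiffAt_unitJac (hg : IsMetric g) (hw : w ∈ unitMomenta g b c x₀) :
    ContDiffAt ℝ ∞ (unitJac g x₀) w := by
  obtain ⟨γ, hγ⟩ := hw.2.2.2
  have hend : ContDiffAt ℝ ∞ (Function.uncurry fun (w : E d × E d × E d) (ζ : E d × E d) =>
      endpoint g 1 x₀ w.1 ζ) (w, w.2) :=
    ContDiffAt.comp (w, w.2) (g := fun w : E d × E d × E d => endpoint g 1 x₀ w.1 w.2)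
      (f := fun v : (E d × E d × E d) × (E d × E d) => (v.1.1, v.2))
      (hg.contDiffAt_endpoint zero_le_one hγ)
      (contDiff_fst.fst.prodMk contDiff_snd).contDiffAt
  have hderiv : ContDiffAt ℝ ∞ (fun w : E d × E d × E d =>
      fderiv ℝ (endpoint g 1 x₀ w.1) w.2) w :=
    ContDiffAt.fderiv hend contDiffAt_snd (by simp)
  exact ContDiffAt.comp w (g := fun M : E d × E d →L[ℝ] E d × E d => M.det)
    contDiff_clm_det.contDiffAt hderiv

theorem IsMetric.exists_equiv_hasFDerivAt_unitEndpoint (hg : IsMetric g)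
    (hw : w ∈ unitMomenta g b c x₀) (hJ : unitJac g x₀ w ≠ 0) :
    ∃ e : (E d × E d × E d) ≃L[ℝ] (E d × E d × E d),
      HasFDerivAt (unitEndpoint g x₀) (e : E d × E d × E d →L[ℝ] E d × E d × E d) w := by
  obtain ⟨γ, hγ⟩ := hw.2.2.2
  set f := fun w : E d × E d × E d => endpoint g 1 x₀ w.1 w.2
  have hf : HasFDerivAt f (fderiv ℝ f w) w :=
    ((hg.contDiffAt_endpoint zero_le_one hγ).differentiableAt (by simp)).hasFDerivAt
  let L := (ContinuousLinearMap.fst ℝ (E d) (E d × E d)).prod (fderiv ℝ f w)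
  have hL : HasFDerivAt (unitEndpoint g x₀) L w := hasFDerivAt_fst.prodMk hf
  have hpartial : HasFDerivAt (endpoint g 1 x₀ w.1)
      ((fderiv ℝ f w).comp (ContinuousLinearMap.inr ℝ (E d) (E d × E d))) w.2 :=
    HasFDerivAt.comp w.2 (g := f) (f := fun ζ => (w.1, ζ)) hf (hasFDerivAt_prodMk_right w.1 w.2)
  rw [unitJac, jac, hpartial.fderiv] at hJ
  have hinj : Function.Injective (L : E d × E d × E d →ₗ[ℝ] E d × E d × E d) := by
    rw [← LinearMap.ker_eq_bot, LinearMap.ker_eq_bot']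
    rintro ⟨δ, ε⟩ hδ
    obtain ⟨rfl, hε⟩ := Prod.mk.inj (show (δ, fderiv ℝ f w (δ, ε)) = (0, 0) from hδ)
    exact congrArg (Prod.mk 0) ((ContinuousLinearMap.toContinuousLinearEquivOfDetNeZero _
      hJ).injective (hε.trans (map_zero _).symm))
  exact ⟨(LinearEquiv.ofInjectiveEndo _ hinj).toContinuousLinearEquiv, hL⟩

theorem unitInverse_mem {o : E d × E d × E d} (ho : o ∈ unitReached g b c x₀) :
    unitInverse g b c x₀ o ∈ unitMomenta g b c x₀ :=
  Function.invFunOn_mem ho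

theorem IsMetric.mem_reached_iff (hg : IsMetric g) {x y : E d} (ht : t ∈ Set.Ioo 0 T)
    (hb : ENNReal.ofReal (t * ‖y₀‖) < b) :
    (t, x, y) ∈ reached g T c x₀ y₀ ↔ (t • y₀, x, t • y) ∈ unitReached g b c x₀ := by
  constructor
  · rintro ⟨-, ζ, hζ, he⟩
    refine ⟨_, (hg.dil_mem_unitMomenta_iff ht.1).2 ⟨hb, hζ⟩, ?_⟩
    rw [hg.unitEndpoint_dil ht.1]
    exact congrArg (fun z : E d × E d => (t • y₀, z.1, t • z.2)) he
  · rintro ⟨w, hw, he⟩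
    obtain ⟨η, ζ, rfl⟩ := exists_eq_dil ht.1.ne' w
    rw [hg.unitEndpoint_dil ht.1] at he
    obtain ⟨hη, hxy⟩ := Prod.mk.inj he
    obtain rfl := smul_right_injective _ ht.1.ne' hη
    obtain ⟨hx, hy⟩ := Prod.mk.inj hxy
    exact ⟨ht, ζ, ((hg.dil_mem_unitMomenta_iff ht.1).1 hw).2,
      Prod.ext hx (smul_right_injective _ ht.1.ne' hy)⟩

namespace UniquelySolvable

theorem injOn_unitEndpoint (h : UniquelySolvable g T b c r x₀) (hg : IsMetric g) (hT : 0 < T) :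
    Set.InjOn (unitEndpoint g x₀) (unitMomenta g b c x₀) := by
  intro w hw w' hw' heq
  obtain ⟨t, ht⟩ := Set.nonempty_Ioo.2 hT
  obtain ⟨η, ζ, rfl⟩ := exists_eq_dil ht.1.ne' w
  obtain ⟨η', ζ', rfl⟩ := exists_eq_dil ht.1.ne' w'
  rw [hg.unitEndpoint_dil ht.1, hg.unitEndpoint_dil ht.1] at heq
  obtain ⟨hη, heq⟩ := Prod.mk.inj heq
  obtain rfl := smul_right_injective _ ht.1.ne' hη
  obtain ⟨hx, hy⟩ := Prod.mk.inj heq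
  rw [hg.dil_mem_unitMomenta_iff ht.1] at hw hw'
  rw [h.inj t ht η hw.1 hw.2 hw'.2 (Prod.ext hx (smul_right_injective _ ht.1.ne' hy))]

theorem unitJac_ne_zero (h : UniquelySolvable g T b c r x₀) (hg : IsMetric g) (hT : 0 < T)
    (hw : w ∈ unitMomenta g b c x₀) : unitJac g x₀ w ≠ 0 := by
  obtain ⟨t, ht⟩ := Set.nonempty_Ioo.2 hT
  obtain ⟨η, ζ, rfl⟩ := exists_eq_dil ht.1.ne' w
  rw [hg.dil_mem_unitMomenta_iff ht.1] at hw
  obtain ⟨γ, hγ⟩ := hw.2.2.2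
  have hJ := h.jac_ne t ht η hw.1 ζ hw.2
  rw [hg.jac_dil ht.1 hγ] at hJ
  exact right_ne_zero_of_mul hJ

theorem mem_unitReached (h : UniquelySolvable g T b c r x₀) (hg : IsMetric g) (hT : 0 < T)
    {η₀ x η : E d} (hb : ENNReal.ofReal ‖η₀‖ < b) (hx : ENNReal.ofReal ‖x - x₀‖ < r)
    (hη : ENNReal.ofReal ‖η - η₀‖ < r) : (η₀, x, η) ∈ unitReached g b c x₀ := by
  obtain ⟨t, ht⟩ := Set.nonempty_Ioo.2 hT
  obtain ⟨y₀, rfl⟩ : ∃ y₀, t • y₀ = η₀ := ⟨t⁻¹ • η₀, smul_inv_smul₀ ht.1.ne' η₀⟩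
  obtain ⟨y, rfl⟩ : ∃ y, t • y = η := ⟨t⁻¹ • η, smul_inv_smul₀ ht.1.ne' η⟩
  rw [norm_smul, Real.norm_of_nonneg ht.1.le] at hb
  rw [← smul_sub, norm_smul, Real.norm_of_nonneg ht.1.le] at hη
  exact (hg.mem_reached_iff ht hb).1 ⟨ht, h.surj t ht y₀ hb ⟨hx, hη⟩⟩

theorem isOpen_unitReached (h : UniquelySolvable g T b c r x₀) (hg : IsMetric g) (hT : 0 < T) :
    IsOpen (unitReached g b c x₀) :=
  isOpen_image_of_hasFDerivAt_equiv (by simp) hg.isOpen_unitMomenta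
    (fun _ hw => hg.contDiffAt_unitEndpoint hw)
    (fun _ hw => hg.exists_equiv_hasFDerivAt_unitEndpoint hw (h.unitJac_ne_zero hg hT hw))

theorem contDiffAt_unitInverse (h : UniquelySolvable g T b c r x₀) (hg : IsMetric g) (hT : 0 < T)
    {o : E d × E d × E d} (ho : o ∈ unitReached g b c x₀) :
    ContDiffAt ℝ ∞ (unitInverse g b c x₀) o := by
  obtain ⟨w, hw, rfl⟩ := ho
  obtain ⟨e, he⟩ := hg.exists_equiv_hasFDerivAt_unitEndpoint hw (h.unitJac_ne_zero hg hT hw)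
  exact contDiffAt_invFunOn (by simp) hg.isOpen_unitMomenta (h.injOn_unitEndpoint hg hT) hw
    (hg.contDiffAt_unitEndpoint hw) he

theorem unitInverse_unitEndpoint (h : UniquelySolvable g T b c r x₀) (hg : IsMetric g)
    (hT : 0 < T) (hw : w ∈ unitMomenta g b c x₀) :
    unitInverse g b c x₀ (unitEndpoint g x₀ w) = w :=
  (h.injOn_unitEndpoint hg hT).leftInvOn_invFunOn hw

theorem isOpen_reached (h : UniquelySolvable g T b c r x₀) (hg : IsMetric g)
    (hb : ∀ t ∈ Set.Ioo 0 T, ENNReal.ofReal (t * ‖y₀‖) < b) : IsOpen (reached g T c x₀ y₀) := by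
  have hpre : reached g T c x₀ y₀ = {z | z.1 ∈ Set.Ioo 0 T} ∩
      (fun z : ℝ × E d × E d => (z.1 • y₀, z.2.1, z.1 • z.2.2)) ⁻¹' unitReached g b c x₀ := by
    ext ⟨t, x, y⟩
    exact ⟨fun hz => ⟨hz.1, (hg.mem_reached_iff hz.1 (hb t hz.1)).1 hz⟩,
      fun hz => (hg.mem_reached_iff hz.1 (hb t hz.1)).2 hz.2⟩
  rcases le_or_gt T 0 with hT | hT
  · rw [hpre, Set.Ioo_eq_empty hT.not_gt]
    simp
  · rw [hpre]
    exact (isOpen_Ioo.preimage continuous_fst).inter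
      ((h.isOpen_unitReached hg hT).preimage (by fun_prop))

end UniquelySolvable

end Endpoint

/-! ### The gradient of the two-point function -/

section Packed

variable {d : ℕ} {u : ℝ → E d → E d → ℝ} {t : ℝ} {x y : E d}

/-- A function of `(t, x, y)` as a function on the product space. -/
def packed (u : ℝ → E d → E d → ℝ) (z : ℝ × E d × E d) : ℝ := u z.1 z.2.1 z.2.2

theorem derivT_eq (hu : DifferentiableAt ℝ (packed u) (t, x, y)) :
    derivT u t x y = fderiv ℝ (packed u) (t, x, y) (1, 0, 0) := by
  have hj : HasDerivAt (fun s : ℝ => (s, x, y)) (1, 0, 0) t :=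
    (hasDerivAt_id t).prodMk (hasDerivAt_const t (x, y))
  exact (HasFDerivAt.comp_hasDerivAt (l := packed u) t hu.hasFDerivAt hj).deriv

theorem inner_gradX (hu : DifferentiableAt ℝ (packed u) (t, x, y)) (v : E d) :
    ⟪gradX u t x y, v⟫_ℝ = fderiv ℝ (packed u) (t, x, y) (0, v, 0) := by
  have hj : HasFDerivAt (fun x : E d => (t, x, y)) ((0 : E d →L[ℝ] ℝ).prod
      ((ContinuousLinearMap.id ℝ (E d)).prod (0 : E d →L[ℝ] E d))) x :=
    (hasFDerivAt_const t x).prodMk ((hasFDerivAt_id x).prodMk (hasFDerivAt_const y x))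
  exact inner_gradient_comp (f := packed u) (j := fun x : E d => (t, x, y)) hu hj v

theorem inner_gradY (hu : DifferentiableAt ℝ (packed u) (t, x, y)) (v : E d) :
    ⟪gradY u t x y, v⟫_ℝ = fderiv ℝ (packed u) (t, x, y) (0, 0, v) := by
  have hj : HasFDerivAt (fun y : E d => (t, x, y)) ((0 : E d →L[ℝ] ℝ).prod
      ((0 : E d →L[ℝ] E d).prod (ContinuousLinearMap.id ℝ (E d)))) y :=
    (hasFDerivAt_const t y).prodMk ((hasFDerivAt_const x y).prodMk (hasFDerivAt_id y))
  exact inner_gradient_comp (f := packed u) (j := fun y : E d => (t, x, y)) hu hj v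

theorem fderiv_packed (hu : DifferentiableAt ℝ (packed u) (t, x, y)) (τ : ℝ) (v w : E d) :
    fderiv ℝ (packed u) (t, x, y) (τ, v, w) =
      τ * derivT u t x y + ⟪gradX u t x y, v⟫_ℝ + ⟪gradY u t x y, w⟫_ℝ := by
  rw [derivT_eq hu, inner_gradX hu, inner_gradY hu, ← smul_eq_mul, ← map_smul, ← map_add, ← map_add]
  simp

theorem contDiffAt_gradY {z : ℝ × E d × E d} (hu : ContDiffAt ℝ 2 (packed u) z) :
    ContDiffAt ℝ 1 (fun z : ℝ × E d × E d => gradY u z.1 z.2.1 z.2.2) z := by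
  refine contDiffAt_of_inner fun v => ?_
  have hpartial : ContDiffAt ℝ 1 (fun z => fderiv ℝ (packed u) z (0, 0, v)) z :=
    (hu.fderiv_right (m := 1) (by norm_num)).clm_apply contDiffAt_const
  refine hpartial.congr_of_eventuallyEq ?_
  filter_upwards [hu.eventually (by simp)] with z' hz'
  exact inner_gradY (hz'.differentiableAt (by simp)) v

theorem hasFDerivAt_space (hu : DifferentiableAt ℝ (packed u) (t, x, y)) :
    HasFDerivAt (fun w : E d × E d => u t w.1 w.2)
      ((innerSL ℝ (gradX u t x y)).coprod (innerSL ℝ (gradY u t x y))) (x, y) := by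
  have hcomp : HasFDerivAt (fun w : E d × E d => u t w.1 w.2) _ (x, y) :=
    HasFDerivAt.comp (x, y) (g := packed u) hu.hasFDerivAt (hasFDerivAt_prodMk_right t (x, y))
  refine hcomp.congr_fderiv (ContinuousLinearMap.ext fun v => ?_)
  exact (fderiv_packed hu 0 v.1 v.2).trans (by rw [zero_mul, zero_add]; rfl)

end Packed

section TwoPoint

variable {d : ℕ} {g : E d → E d →L[ℝ] E d} {t : ℝ} {x₀ y₀ : E d} {ζ : E d × E d} {γ : ℝ → Phase d}

/-- The projection `(x, y, p, q) ↦ (x, y)`. -/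
def baseProj : Phase d →L[ℝ] E d × E d :=
  (ContinuousLinearMap.fst ℝ (E d) (E d × E d × E d)).prod
    ((ContinuousLinearMap.fst ℝ (E d) (E d × E d)).comp
      (ContinuousLinearMap.snd ℝ (E d) (E d × E d × E d)))

/-- The inclusion `(p, q) ↦ (0, 0, p, q)`. -/
def momIncl : E d × E d →L[ℝ] Phase d :=
  (ContinuousLinearMap.inr ℝ (E d) (E d × E d × E d)).comp
    (ContinuousLinearMap.inr ℝ (E d) (E d × E d))

theorem hasFDerivAt_momIncl (x₀ y₀ : E d) (ζ : E d × E d) :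
    HasFDerivAt (fun ζ : E d × E d => ((x₀, y₀, ζ) : Phase d)) momIncl ζ :=
  HasFDerivAt.comp ζ (g := fun w => (x₀, w)) (hasFDerivAt_prodMk_right x₀ (y₀, ζ))
    (hasFDerivAt_prodMk_right y₀ ζ)

theorem IsMetric.eventually_mem_momenta_right (hg : IsMetric g) (ht : 0 ≤ t) {c : ℝ≥0∞}
    (h : ζ ∈ momenta g c t x₀ y₀) : ∀ᶠ ζ' in 𝓝 ζ, ζ' ∈ momenta g c t x₀ y₀ :=
  (hasFDerivAt_prodMk_right (𝕜 := ℝ) y₀ ζ).continuousAt.eventually (hg.eventually_mem_momenta ht h)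

section Flow

variable {ht : 0 ≤ t} {Γ : Phase d → C(Set.Icc 0 t, Phase d)}

theorem IsLocalFlow.eventually_isCharacteristic_right {n : ℕ∞ω}
    (h : IsLocalFlow n (hamField g) ht (x₀, y₀, ζ) Γ) :
    ∀ᶠ ζ' in 𝓝 ζ, IsCharacteristic g t x₀ y₀ ζ' (Set.IccExtend ht (Γ (x₀, y₀, ζ'))) :=
  (hasFDerivAt_prodMk_right (𝕜 := ℝ) y₀ ζ).continuousAt.eventually h.eventually_isCharacteristic

theorem IsLocalFlow.fderiv_endpoint (h : IsLocalFlow ∞ (hamField g) ht (x₀, y₀, ζ) Γ)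
    (hg : IsMetric g) {s : ℝ} (hs : s ∈ Set.Icc 0 t) :
    fderiv ℝ (endpoint g s x₀ y₀) ζ =
      baseProj.comp ((variation ht Γ (x₀, y₀, ζ) s).comp momIncl) := by
  have hflow : HasFDerivAt (fun ζ' => Set.IccExtend ht (Γ (x₀, y₀, ζ')) s) _ ζ :=
    HasFDerivAt.comp ζ (g := fun z => Set.IccExtend ht (Γ z) s) (h.hasFDerivAt_apply (by simp) s)
      (hasFDerivAt_momIncl x₀ y₀ ζ)
  refine ((baseProj.hasFDerivAt.comp ζ hflow).congr_of_eventuallyEq ?_).fderiv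
  filter_upwards [h.eventually_isCharacteristic_right] with ζ' hζ'
  exact hg.endpoint_eq hs.1 (hζ'.mono hs.2)

theorem IsLocalFlow.integral_fderiv_lagrangian
    (h : IsLocalFlow ∞ (hamField g) ht (x₀, y₀, ζ) Γ) (hg : IsMetric g) (δ : E d × E d) :
    ∫ s in (0 : ℝ)..t, fderiv ℝ (lagrangian g) (Set.IccExtend ht (Γ (x₀, y₀, ζ)) s)
        (variation ht Γ (x₀, y₀, ζ) s (momIncl δ)) =
      ⟪(Set.IccExtend ht (Γ (x₀, y₀, ζ)) t).2.2.1,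
        (variation ht Γ (x₀, y₀, ζ) t (momIncl δ)).1⟫_ℝ +
      ⟪(Set.IccExtend ht (Γ (x₀, y₀, ζ)) t).2.2.2,
        (variation ht Γ (x₀, y₀, ζ) t (momIncl δ)).2.1⟫_ℝ := by
  have hV : ContDiff ℝ 1 (hamField g) := hg.contDiff_hamField.of_le (by simp)
  have hγ := h.eventually_isCharacteristic_right.self_of_nhds.isIntegralCurveOn
  have hη : ∀ s ∈ Set.Icc 0 t, HasDerivWithinAt _ _ (Set.Icc 0 t) s := fun s hs =>
    h.hasDerivWithinAt_variation (by simp) hV (momIncl δ) hs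
  have hη₀ : variation ht Γ (x₀, y₀, ζ) 0 (momIncl δ) = (0, 0, δ) := by
    rw [h.variation_zero (by simp) hV]
    rfl
  set γ := Set.IccExtend ht (Γ (x₀, y₀, ζ))
  set η := fun s => variation ht Γ (x₀, y₀, ζ) s (momIncl δ)
  change ∫ s in (0 : ℝ)..t, fderiv ℝ (lagrangian g) (γ s) (η s) =
    ⟪(γ t).2.2.1, (η t).1⟫_ℝ + ⟪(γ t).2.2.2, (η t).2.1⟫_ℝ
  have hpairing : ∀ s ∈ Set.Icc 0 t, HasDerivWithinAt
      (fun s => ⟪(γ s).2.2.1, (η s).1⟫_ℝ + ⟪(γ s).2.2.2, (η s).2.1⟫_ℝ)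
      (fderiv ℝ (lagrangian g) (γ s) (η s)) (Set.Icc 0 t) s := fun s hs => by
    have hp : HasDerivWithinAt (fun s => (γ s).2.2.1) (hamField g (γ s)).2.2.1 (Set.Icc 0 t) s :=
      (hγ s hs).snd.snd.fst
    have hq : HasDerivWithinAt (fun s => (γ s).2.2.2) (hamField g (γ s)).2.2.2 (Set.Icc 0 t) s :=
      (hγ s hs).snd.snd.snd
    refine ((hp.inner ℝ (hη s hs).fst).add (hq.inner ℝ (hη s hs).snd.fst)).congr_deriv ?_
    rw [hg.fderiv_lagrangian]
    ring
  have hint : IntervalIntegrable (fun s => fderiv ℝ (lagrangian g) (γ s) (η s))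
      MeasureTheory.volume 0 t := by
    refine ContinuousOn.intervalIntegrable_of_Icc ht ?_
    exact ((hg.contDiff_lagrangian.continuous_fderiv (by simp)).comp_continuousOn
      hγ.continuousOn).clm_apply fun s hs => (hη s hs).continuousWithinAt
  rw [intervalIntegral.integral_eq_sub_of_hasDerivAt_of_le ht
    (fun s hs => (hpairing s hs).continuousWithinAt)
    (fun s hs => (hpairing s ⟨hs.1.le, hs.2.le⟩).hasDerivAt (Icc_mem_nhds hs.1 hs.2)) hint]
  simp [show η 0 = (0, 0, δ) from hη₀]

/-- The first variation of the action, `dS = P dX + Q dY`. -/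
theorem IsLocalFlow.hasFDerivAt_action (h : IsLocalFlow ∞ (hamField g) ht (x₀, y₀, ζ) Γ)
    (hg : IsMetric g) :
    HasFDerivAt (fun ζ' => action g t (Set.IccExtend ht (Γ (x₀, y₀, ζ'))))
      (((innerSL ℝ (Set.IccExtend ht (Γ (x₀, y₀, ζ)) t).2.2.1).coprod
        (innerSL ℝ (Set.IccExtend ht (Γ (x₀, y₀, ζ)) t).2.2.2)).comp
          (fderiv ℝ (endpoint g t x₀ y₀) ζ)) ζ := by
  obtain ⟨A, hA, hA_apply⟩ :=
    h.hasFDerivAt_integral (by simp) (hg.contDiff_lagrangian.of_le (by simp))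
  have hcomp : HasFDerivAt (fun ζ' => action g t (Set.IccExtend ht (Γ (x₀, y₀, ζ'))))
      (A.comp momIncl) ζ :=
    HasFDerivAt.comp ζ
      (g := fun z => ∫ s in (0 : ℝ)..t, lagrangian g (Set.IccExtend ht (Γ z) s)) hA
      (hasFDerivAt_momIncl x₀ y₀ ζ)
  refine hcomp.congr_fderiv (ContinuousLinearMap.ext fun δ => ?_)
  rw [h.fderiv_endpoint hg ⟨ht, le_rfl⟩]
  exact (hA_apply _).trans (h.integral_fderiv_lagrangian hg δ)

end Flow

variable {T : ℝ} {c : ℝ≥0∞} {S : ℝ → E d → E d → ℝ}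

theorem IsTwoPointFunction.hasFDerivAt_comp_endpoint (hS : IsTwoPointFunction g T c x₀ y₀ S)
    (hg : IsMetric g) (ht : t ∈ Set.Ioo 0 T) (hζ : ζ ∈ momenta g c t x₀ y₀)
    (hγ : IsCharacteristic g t x₀ y₀ ζ γ) :
    HasFDerivAt (fun ζ' => S t (endpoint g t x₀ y₀ ζ').1 (endpoint g t x₀ y₀ ζ').2)
      (((innerSL ℝ (γ t).2.2.1).coprod (innerSL ℝ (γ t).2.2.2)).comp
        (fderiv ℝ (endpoint g t x₀ y₀) ζ)) ζ := by
  obtain ⟨Γ, hΓ, hΓγ⟩ := hg.exists_isLocalFlow ht.1.le hγ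
  rw [← hΓγ ⟨ht.1.le, le_rfl⟩]
  refine (hΓ.hasFDerivAt_action hg).congr_of_eventuallyEq ?_
  filter_upwards [hΓ.eventually_isCharacteristic_right,
    hg.eventually_mem_momenta_right ht.1.le hζ] with ζ' hchar hmem
  rw [hg.endpoint_eq ht.1.le hchar]
  exact hS t ht ζ' hmem _ hchar

theorem IsTwoPointFunction.grad_eq (hS : IsTwoPointFunction g T c x₀ y₀ S) (hg : IsMetric g)
    (ht : t ∈ Set.Ioo 0 T) (hζ : ζ ∈ momenta g c t x₀ y₀) (hγ : IsCharacteristic g t x₀ y₀ ζ γ)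
    (hJ : jac g t x₀ y₀ ζ ≠ 0)
    (hdiff : DifferentiableAt ℝ (packed S) (t, (γ t).1, (γ t).2.1)) :
    gradX S t (γ t).1 (γ t).2.1 = (γ t).2.2.1 ∧ gradY S t (γ t).1 (γ t).2.1 = (γ t).2.2.2 := by
  have hchain : HasFDerivAt
      (fun ζ' => S t (endpoint g t x₀ y₀ ζ').1 (endpoint g t x₀ y₀ ζ').2) _ ζ :=
    HasFDerivAt.comp ζ (g := fun w : E d × E d => S t w.1 w.2)
      (by rw [hg.endpoint_eq ht.1.le hγ]; exact hasFDerivAt_space hdiff)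
      (hg.hasFDerivAt_endpoint ht.1.le hγ)
  have hcomp := hchain.unique (hS.hasFDerivAt_comp_endpoint hg ht hζ hγ)
  have heq : ∀ v : E d × E d,
      ⟪gradX S t (γ t).1 (γ t).2.1, v.1⟫_ℝ + ⟪gradY S t (γ t).1 (γ t).2.1, v.2⟫_ℝ =
      ⟪(γ t).2.2.1, v.1⟫_ℝ + ⟪(γ t).2.2.2, v.2⟫_ℝ := fun v => by
    obtain ⟨δ, rfl⟩ := (ContinuousLinearMap.toContinuousLinearEquivOfDetNeZero _ hJ).surjective v
    exact DFunLike.congr_fun hcomp δ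
  refine ⟨ext_inner_right ℝ fun v => ?_, ext_inner_right ℝ fun v => ?_⟩
  · simpa using heq (v, 0)
  · simpa using heq (0, v)

end TwoPoint

/-! ### The amplitude along characteristics -/

section Velocity

variable {d : ℕ} {g : E d → E d →L[ℝ] E d} {S : ℝ → E d → E d → ℝ} {s : ℝ} {x y : E d}

/-- The velocity field `(∂H/∂p, ∂H/∂q)` on the base with the momenta given by the gradient of `S`.
It only involves `∂S/∂y`, since `∂H/∂p` does not depend on the momenta. -/
def velocity (g : E d → E d →L[ℝ] E d) (S : ℝ → E d → E d → ℝ) (s : ℝ) (w : E d × E d) :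
    E d × E d :=
  (-coG g w.1 w.2, g w.1 (gradY S s w.1 w.2) + (1 / 2 : ℝ) • force g w.1 w.2)

theorem IsMetric.hasFDerivAt_force (hg : IsMetric g) (x y : E d) :
    HasFDerivAt (force g x) (fderiv ℝ (force g x) y) y := by
  have hforce : ContDiff ℝ ∞ (force g x) :=
    ContDiff.comp (g := fun w : E d × E d => force g w.1 w.2) (f := fun y => (x, y))
      hg.contDiff_force (contDiff_const.prodMk contDiff_id)
  exact (hforce.differentiable (by simp) y).hasFDerivAt

theorem IsMetric.inner_fderiv_force (hg : IsMetric g) (x y v w : E d) :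
    ⟪fderiv ℝ (force g x) y w, v⟫_ℝ = 2 * ⟪fderiv ℝ (coG g) x v y, w⟫_ℝ := by
  have hleft : HasFDerivAt (fun y => ⟪force g x y, v⟫_ℝ) _ y :=
    (hg.hasFDerivAt_force x y).inner ℝ (hasFDerivAt_const v y)
  have hright : HasFDerivAt (fun y => ⟪fderiv ℝ (coG g) x v y, y⟫_ℝ) _ y :=
    (fderiv ℝ (coG g) x v).hasFDerivAt.inner ℝ (hasFDerivAt_id y)
  simp_rw [hg.inner_force] at hleft
  have heq := DFunLike.congr_fun (hleft.unique hright) w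
  simp only [ContinuousLinearMap.comp_apply, ContinuousLinearMap.prod_apply,
    fderivInnerCLM_apply, zero_apply, inner_zero_right, zero_add,
    ContinuousLinearMap.id_apply] at heq
  rw [heq, hg.fderiv_coG_symm x v w y, real_inner_comm w]
  ring

theorem IsMetric.trace_fderiv_force (hg : IsMetric g) (x y : E d) :
    LinearMap.trace ℝ (E d) (fderiv ℝ (force g x) y : E d →ₗ[ℝ] E d) =
      2 * LinearMap.trace ℝ (E d) ((fderiv ℝ (coG g) x).flip y : E d →ₗ[ℝ] E d) := by
  rw [LinearMap.trace_eq_sum_inner _ (EuclideanSpace.basisFun (Fin d) ℝ),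
    LinearMap.trace_eq_sum_inner _ (EuclideanSpace.basisFun (Fin d) ℝ), Finset.mul_sum]
  refine Finset.sum_congr rfl fun i _ => ?_
  rw [real_inner_comm]
  refine (hg.inner_fderiv_force x y _ _).trans ?_
  rw [real_inner_comm]
  rfl

theorem differentiableAt_gradY (hS : ContDiffAt ℝ 2 (packed S) (s, x, y)) :
    DifferentiableAt ℝ (fun w : E d × E d => gradY S s w.1 w.2) (x, y) :=
  DifferentiableAt.comp (x, y) (g := fun z : ℝ × E d × E d => gradY S z.1 z.2.1 z.2.2)
    ((contDiffAt_gradY hS).differentiableAt (by simp))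
    (hasFDerivAt_prodMk_right s (x, y)).differentiableAt

theorem hasFDerivAt_gradY_fibre (hS : ContDiffAt ℝ 2 (packed S) (s, x, y)) :
    HasFDerivAt (fun y' => gradY S s x y') (fderiv ℝ (fun y' => gradY S s x y') y) y :=
  (DifferentiableAt.comp y (g := fun w : E d × E d => gradY S s w.1 w.2)
    (f := fun y' => (x, y')) (differentiableAt_gradY hS)
    (hasFDerivAt_prodMk_right x y).differentiableAt).hasFDerivAt

theorem IsMetric.hasFDerivAt_velocity (hg : IsMetric g)
    (hS : ContDiffAt ℝ 2 (packed S) (s, x, y)) :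
    HasFDerivAt (velocity g S s) (fderiv ℝ (velocity g S s) (x, y)) (x, y) := by
  have hgx : DifferentiableAt ℝ (fun w : E d × E d => g w.1) (x, y) :=
    DifferentiableAt.comp (x, y) (g := g) (hg.smooth.differentiable (by simp) x)
      differentiableAt_fst
  have hGx : DifferentiableAt ℝ (fun w : E d × E d => coG g w.1) (x, y) :=
    DifferentiableAt.comp (x, y) (g := coG g) (hg.contDiff_coG.differentiable (by simp) x)
      differentiableAt_fst
  have hforce : DifferentiableAt ℝ (fun w : E d × E d => force g w.1 w.2) (x, y) :=
    hg.contDiff_force.differentiable (by simp) _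
  exact DifferentiableAt.hasFDerivAt <| (hGx.clm_apply differentiableAt_snd).neg.prodMk
    ((hgx.clm_apply (differentiableAt_gradY hS)).add (hforce.const_smul (1 / 2 : ℝ)))

theorem IsMetric.fst_fderiv_velocity_inl (hg : IsMetric g)
    (hS : ContDiffAt ℝ 2 (packed S) (s, x, y)) :
    (ContinuousLinearMap.fst ℝ (E d) (E d)).comp ((fderiv ℝ (velocity g S s) (x, y)).comp
      (ContinuousLinearMap.inl ℝ _ _)) = -(fderiv ℝ (coG g) x).flip y := by
  have hvel : HasFDerivAt (fun x' => -coG g x' y) _ x :=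
    (HasFDerivAt.comp x (g := velocity g S s) (f := fun x' => (x', y))
      (hg.hasFDerivAt_velocity hS) (hasFDerivAt_prodMk_left x y)).fst
  refine hvel.unique ?_
  refine (((hg.hasFDerivAt_coG x).clm_apply (hasFDerivAt_const y x)).neg).congr_fderiv ?_
  ext v
  simp

theorem IsMetric.snd_fderiv_velocity_inr (hg : IsMetric g)
    (hS : ContDiffAt ℝ 2 (packed S) (s, x, y)) :
    (ContinuousLinearMap.snd ℝ (E d) (E d)).comp ((fderiv ℝ (velocity g S s) (x, y)).comp
      (ContinuousLinearMap.inr ℝ _ _)) =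
      (g x).comp (fderiv ℝ (fun y' => gradY S s x y') y) +
        (1 / 2 : ℝ) • fderiv ℝ (force g x) y := by
  have hvel : HasFDerivAt (fun y' => g x (gradY S s x y') + (1 / 2 : ℝ) • force g x y') _ y :=
    (HasFDerivAt.comp y (g := velocity g S s) (f := fun y' => (x, y'))
      (hg.hasFDerivAt_velocity hS) (hasFDerivAt_prodMk_right x y)).snd
  exact hvel.unique <|
    ((g x).hasFDerivAt.comp y (hasFDerivAt_gradY_fibre hS)).add
      ((hg.hasFDerivAt_force x y).const_smul (1 / 2 : ℝ))

/-- The terms containing `∂G/∂x` cancel. -/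
theorem IsMetric.trace_fderiv_velocity (hg : IsMetric g)
    (hS : ContDiffAt ℝ 2 (packed S) (s, x, y)) :
    LinearMap.trace ℝ (E d × E d) (fderiv ℝ (velocity g S s) (x, y)) = trHessY g S s x y := by
  have hfst := congrArg (fun L : E d →L[ℝ] E d => LinearMap.trace ℝ (E d) (L : E d →ₗ[ℝ] E d))
    (hg.fst_fderiv_velocity_inl hS)
  have hsnd := congrArg (fun L : E d →L[ℝ] E d => LinearMap.trace ℝ (E d) (L : E d →ₗ[ℝ] E d))
    (hg.snd_fderiv_velocity_inr hS)
  simp only [ContinuousLinearMap.toLinearMap_neg, ContinuousLinearMap.toLinearMap_add,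
    ContinuousLinearMap.toLinearMap_smul, map_neg, map_add, map_smul, hg.trace_fderiv_force,
    smul_eq_mul] at hfst hsnd
  rw [trace_prod_eq]
  refine (congrArg₂ (· + ·) hfst hsnd).trans ?_
  rw [trHessY]
  ring

end Velocity

section Amplitude

variable {d : ℕ} {g : E d → E d →L[ℝ] E d} {T t s : ℝ} {b c r : ℝ≥0∞} {x₀ y₀ : E d}
  {ζ : E d × E d} {γ : ℝ → Phase d} {S φ : ℝ → E d → E d → ℝ} {κ : ℝ}

/-- `S` is a two-point function of class `C²`; it serves as the phase of the ansatz. -/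
structure IsPhase (g : E d → E d →L[ℝ] E d) (T : ℝ) (c : ℝ≥0∞) (x₀ y₀ : E d)
    (S : ℝ → E d → E d → ℝ) : Prop where
  contDiffOn : ContDiffOn ℝ 2 (packed S) (reached g T c x₀ y₀)
  isTwoPointFunction : IsTwoPointFunction g T c x₀ y₀ S

/-- `φ` is an amplitude for the phase `S`: a solution of class `C²` of the transport equation such
that `t^{2d} φ` converges to `κ` at the starting point. -/
structure IsAmplitude (g : E d → E d →L[ℝ] E d) (T : ℝ) (c : ℝ≥0∞) (x₀ y₀ : E d)
    (S φ : ℝ → E d → E d → ℝ) (κ : ℝ) : Prop where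
  contDiffOn : ContDiffOn ℝ 2 (packed φ) (reached g T c x₀ y₀)
  transport : Transport g (reached g T c x₀ y₀) S φ
  tendsto : Filter.Tendsto (fun z : ℝ × E d × E d => z.1 ^ (2 * d) * packed φ z)
    (𝓝[reached g T c x₀ y₀] (0, x₀, y₀)) (𝓝 κ)

theorem IsMetric.mem_reached (hg : IsMetric g) (ht : t ∈ Set.Ioo 0 T)
    (hζ : ζ ∈ momenta g c t x₀ y₀) (hγ : IsCharacteristic g t x₀ y₀ ζ γ) :
    (t, (γ t).1, (γ t).2.1) ∈ reached g T c x₀ y₀ :=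
  ⟨ht, ζ, hζ, hg.endpoint_eq ht.1.le hγ⟩

namespace UniquelySolvable

theorem contDiffAt_of_contDiffOn_reached (h : UniquelySolvable g T b c r x₀) (hg : IsMetric g)
    (hb : ∀ t ∈ Set.Ioo 0 T, ENNReal.ofReal (t * ‖y₀‖) < b) {n : ℕ∞ω} {f : ℝ × E d × E d → ℝ}
    (hf : ContDiffOn ℝ n f (reached g T c x₀ y₀)) {z : ℝ × E d × E d}
    (hz : z ∈ reached g T c x₀ y₀) : ContDiffAt ℝ n f z :=
  hf.contDiffAt ((h.isOpen_reached hg hb).mem_nhds hz)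

theorem gradY_eq (h : UniquelySolvable g T b c r x₀) (hg : IsMetric g)
    (hb : ∀ t ∈ Set.Ioo 0 T, ENNReal.ofReal (t * ‖y₀‖) < b) (hS : IsPhase g T c x₀ y₀ S)
    (ht : t ∈ Set.Ioo 0 T) (hζ : ζ ∈ momenta g c t x₀ y₀) (hγ : IsCharacteristic g t x₀ y₀ ζ γ) :
    gradY S t (γ t).1 (γ t).2.1 = (γ t).2.2.2 :=
  (hS.isTwoPointFunction.grad_eq hg ht hζ hγ (h.jac_ne t ht y₀ (hb t ht) ζ hζ)
    ((h.contDiffAt_of_contDiffOn_reached hg hb hS.contDiffOn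
      (hg.mem_reached ht hζ hγ)).differentiableAt (by simp))).2

theorem velocity_eq (h : UniquelySolvable g T b c r x₀) (hg : IsMetric g)
    (hb : ∀ t ∈ Set.Ioo 0 T, ENNReal.ofReal (t * ‖y₀‖) < b) (hS : IsPhase g T c x₀ y₀ S)
    (ht : t ∈ Set.Ioo 0 T) (hζ : ζ ∈ momenta g c t x₀ y₀) (hγ : IsCharacteristic g t x₀ y₀ ζ γ) :
    velocity g S t ((γ t).1, (γ t).2.1) = baseProj (hamField g (γ t)) := by
  rw [velocity, h.gradY_eq hg hb hS ht hζ hγ, ← hamField_fst, ← hg.hamField_snd]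
  rfl

theorem fderiv_velocity_comp_fderiv_endpoint (h : UniquelySolvable g T b c r x₀)
    (hg : IsMetric g) (hb : ∀ t ∈ Set.Ioo 0 T, ENNReal.ofReal (t * ‖y₀‖) < b)
    (hS : IsPhase g T c x₀ y₀ S) {ht : 0 ≤ t} {Γ : Phase d → C(Set.Icc 0 t, Phase d)}
    (hΓ : IsLocalFlow ∞ (hamField g) ht (x₀, y₀, ζ) Γ)
    (hΓγ : Set.EqOn (Set.IccExtend ht (Γ (x₀, y₀, ζ))) γ (Set.Icc 0 t))
    (hs : s ∈ Set.Icc 0 t) (hsT : s ∈ Set.Ioo 0 T) (hζ : ζ ∈ momenta g c s x₀ y₀)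
    (hγ : IsCharacteristic g s x₀ y₀ ζ γ) :
    (fderiv ℝ (velocity g S s) ((γ s).1, (γ s).2.1)).comp (fderiv ℝ (endpoint g s x₀ y₀) ζ) =
      baseProj.comp ((fderiv ℝ (hamField g) (γ s)).comp
        ((variation ht Γ (x₀, y₀, ζ) s).comp momIncl)) := by
  have hvel : HasFDerivAt (fun ζ' => velocity g S s (endpoint g s x₀ y₀ ζ')) _ ζ :=
    HasFDerivAt.comp ζ (g := velocity g S s) (by
      rw [hg.endpoint_eq hs.1 hγ]
      exact hg.hasFDerivAt_velocity (h.contDiffAt_of_contDiffOn_reached hg hb hS.contDiffOn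
        (hg.mem_reached hsT hζ hγ))) (hg.hasFDerivAt_endpoint hs.1 hγ)
  have hflow : HasFDerivAt (fun ζ' => Set.IccExtend ht (Γ (x₀, y₀, ζ')) s) _ ζ :=
    HasFDerivAt.comp ζ (g := fun z => Set.IccExtend ht (Γ z) s) (hΓ.hasFDerivAt_apply (by simp) s)
      (hasFDerivAt_momIncl x₀ y₀ ζ)
  have hfield : HasFDerivAt (fun ζ' => hamField g (Set.IccExtend ht (Γ (x₀, y₀, ζ')) s)) _ ζ :=
    HasFDerivAt.comp ζ (g := hamField g) (by
      rw [hΓγ hs]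
      exact (hg.contDiff_hamField.differentiable (by simp) _).hasFDerivAt) hflow
  refine (hvel.congr_of_eventuallyEq ?_).unique (baseProj.hasFDerivAt.comp ζ hfield)
  filter_upwards [hΓ.eventually_isCharacteristic_right, hg.eventually_mem_momenta_right hs.1 hζ]
    with ζ' hchar hmem
  have hchar_s := hchar.mono hs.2
  rw [Function.comp_apply, hg.endpoint_eq hs.1 hchar_s, h.velocity_eq hg hb hS hsT hmem hchar_s]

theorem hasDerivAt_fderiv_endpoint (h : UniquelySolvable g T b c r x₀) (hg : IsMetric g)
    (hb : ∀ t ∈ Set.Ioo 0 T, ENNReal.ofReal (t * ‖y₀‖) < b) (hS : IsPhase g T c x₀ y₀ S)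
    (ht : t ∈ Set.Ioo 0 T) (hζ : ζ ∈ momenta g c t x₀ y₀) (hγ : IsCharacteristic g t x₀ y₀ ζ γ)
    (hs : s ∈ Set.Ioo 0 t) (v : E d × E d) :
    HasDerivAt (fun r => fderiv ℝ (endpoint g r x₀ y₀) ζ v)
      (fderiv ℝ (velocity g S s) ((γ s).1, (γ s).2.1) (fderiv ℝ (endpoint g s x₀ y₀) ζ v)) s := by
  obtain ⟨Γ, hΓ, hΓγ⟩ := hg.exists_isLocalFlow ht.1.le hγ
  have hsI : s ∈ Set.Icc 0 t := ⟨hs.1.le, hs.2.le⟩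
  have hnhds : Set.Icc 0 t ∈ 𝓝 s := Icc_mem_nhds hs.1 hs.2
  have hvar := (hΓ.hasDerivWithinAt_variation (by simp) (hg.contDiff_hamField.of_le (by simp))
    (momIncl v) hsI).hasDerivAt hnhds
  rw [hΓγ hsI] at hvar
  have hcomp := DFunLike.congr_fun (h.fderiv_velocity_comp_fderiv_endpoint hg hb hS hΓ hΓγ hsI
    ⟨hs.1, hs.2.trans ht.2⟩ (momenta_anti hs.1.le hs.2.le hζ) (hγ.mono hs.2.le)) v
  refine (((baseProj.hasFDerivAt.comp_hasDerivAt s hvar).congr_deriv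
    hcomp.symm).congr_of_eventuallyEq ?_)
  filter_upwards [hnhds] with r hr
  rw [hΓ.fderiv_endpoint hg hr]
  rfl

theorem hasDerivAt_jac (h : UniquelySolvable g T b c r x₀) (hg : IsMetric g)
    (hb : ∀ t ∈ Set.Ioo 0 T, ENNReal.ofReal (t * ‖y₀‖) < b) (hS : IsPhase g T c x₀ y₀ S)
    (ht : t ∈ Set.Ioo 0 T) (hζ : ζ ∈ momenta g c t x₀ y₀) (hγ : IsCharacteristic g t x₀ y₀ ζ γ)
    (hs : s ∈ Set.Ioo 0 t) :
    HasDerivAt (fun r => jac g r x₀ y₀ ζ)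
      (trHessY g S s (γ s).1 (γ s).2.1 * jac g s x₀ y₀ ζ) s := by
  have hreach := hg.mem_reached ⟨hs.1, hs.2.trans ht.2⟩ (momenta_anti hs.1.le hs.2.le hζ)
    (hγ.mono hs.2.le)
  rw [← hg.trace_fderiv_velocity (h.contDiffAt_of_contDiffOn_reached hg hb hS.contDiffOn hreach)]
  exact hasDerivAt_det (h.hasDerivAt_fderiv_endpoint hg hb hS ht hζ hγ hs)

theorem hasDerivAt_amplitude (h : UniquelySolvable g T b c r x₀) (hg : IsMetric g)
    (hb : ∀ t ∈ Set.Ioo 0 T, ENNReal.ofReal (t * ‖y₀‖) < b) (hS : IsPhase g T c x₀ y₀ S)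
    (hφ : IsAmplitude g T c x₀ y₀ S φ κ) (ht : t ∈ Set.Ioo 0 T) (hζ : ζ ∈ momenta g c t x₀ y₀)
    (hγ : IsCharacteristic g t x₀ y₀ ζ γ) (hs : s ∈ Set.Ioo 0 t) :
    HasDerivAt (fun r => φ r (γ r).1 (γ r).2.1)
      (-(1 / 2) * φ s (γ s).1 (γ s).2.1 * trHessY g S s (γ s).1 (γ s).2.1) s := by
  have hsT : s ∈ Set.Ioo 0 T := ⟨hs.1, hs.2.trans ht.2⟩
  have hζs := momenta_anti hs.1.le hs.2.le hζ
  have hγs := hγ.mono hs.2.le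
  have hreach := hg.mem_reached hsT hζs hγs
  have hγ' := (hγ.ode s ⟨hs.1.le, hs.2.le⟩).hasDerivAt (Icc_mem_nhds hs.1 hs.2)
  have hφ' : DifferentiableAt ℝ (packed φ) (s, (γ s).1, (γ s).2.1) :=
    (h.contDiffAt_of_contDiffOn_reached hg hb hφ.contDiffOn hreach).differentiableAt (by simp)
  have hcurve : HasDerivAt (fun r => (r, (γ r).1, (γ r).2.1))
      (1, (hamField g (γ s)).1, (hamField g (γ s)).2.1) s :=
    (hasDerivAt_id s).prodMk (hγ'.fst.prodMk hγ'.snd.fst)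
  refine (HasFDerivAt.comp_hasDerivAt (l := packed φ) s hφ'.hasFDerivAt hcurve).congr_deriv ?_
  rw [fderiv_packed hφ', hamField_fst, hg.hamField_snd, ← h.gradY_eq hg hb hS hsT hζs hγs]
  have htransport := hφ.transport _ _ _ hreach
  rw [inner_add_right, inner_smul_right, inner_neg_right,
    real_inner_comm (coG g (γ s).1 (γ s).2.1),
    real_inner_comm (force g (γ s).1 (γ s).2.1), real_inner_comm (g (γ s).1 _)]
  linarith

end UniquelySolvable

theorem hasDerivAt_sqrt_abs {f : ℝ → ℝ} {a s : ℝ} (hf : HasDerivAt f (a * f s) s)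
    (h0 : f s ≠ 0) : HasDerivAt (fun r => √|f r|) (a / 2 * √|f s|) s := by
  have habs : HasDerivAt (fun r => |f r|) (a * |f s|) s :=
    ((hasDerivAt_abs h0).comp s hf).congr_deriv (by rw [mul_left_comm, sign_mul_self])
  refine (habs.sqrt (abs_pos.2 h0).ne').congr_deriv ?_
  rw [mul_div_mul_comm, Real.div_sqrt]

theorem UniquelySolvable.hasDerivAt_amplitude_mul_sqrt_jac (h : UniquelySolvable g T b c r x₀)
    (hg : IsMetric g) (hb : ∀ t ∈ Set.Ioo 0 T, ENNReal.ofReal (t * ‖y₀‖) < b)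
    (hS : IsPhase g T c x₀ y₀ S) (hφ : IsAmplitude g T c x₀ y₀ S φ κ) (ht : t ∈ Set.Ioo 0 T)
    (hζ : ζ ∈ momenta g c t x₀ y₀) (hγ : IsCharacteristic g t x₀ y₀ ζ γ) (hs : s ∈ Set.Ioo 0 t) :
    HasDerivAt (fun r => φ r (γ r).1 (γ r).2.1 * √|jac g r x₀ y₀ ζ|) 0 s := by
  have hsT : s ∈ Set.Ioo 0 T := ⟨hs.1, hs.2.trans ht.2⟩
  have hJ := h.jac_ne s hsT y₀ (hb s hsT) ζ (momenta_anti hs.1.le hs.2.le hζ)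
  exact ((h.hasDerivAt_amplitude hg hb hS hφ ht hζ hγ hs).mul
    (hasDerivAt_sqrt_abs (h.hasDerivAt_jac hg hb hS ht hζ hγ hs) hJ)).congr_deriv (by ring)

end Amplitude

theorem eq_of_tendsto_of_hasDerivAt_zero {F : Type*} [NormedAddCommGroup F] [NormedSpace ℝ F]
    {f : ℝ → F} {a b : ℝ} {l : F} (hab : a < b) (hf : ContinuousOn f (Set.Ioc a b))
    (hf' : ∀ s ∈ Set.Ioo a b, HasDerivAt f 0 s) (hl : Filter.Tendsto f (𝓝[>] a) (𝓝 l)) :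
    f b = l := by
  refine tendsto_nhds_unique (tendsto_const_nhds.congr' ?_) hl
  filter_upwards [Ioo_mem_nhdsGT hab] with s hs
  exact constant_of_has_deriv_right_zero
    (hf.mono fun u hu => ⟨hs.1.trans_le hu.1, hu.2⟩)
    (fun u hu => (hf' u ⟨hs.1.trans_le hu.1, hu.2⟩).hasDerivWithinAt) b ⟨hs.2.le, le_rfl⟩

section AmplitudeFormula

variable {d : ℕ} {g : E d → E d →L[ℝ] E d}
  {T t s : ℝ} {b c r : ℝ≥0∞} {x₀ y₀ : E d} {ζ : E d × E d} {γ : ℝ → Phase d}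
  {S φ : ℝ → E d → E d → ℝ} {κ : ℝ}

theorem IsMetric.hamField_rest (hg : IsMetric g) (x : E d) : hamField g (x, 0, 0, 0) = 0 := by
  have hforce : ∀ x', force g x' 0 = 0 := fun x' => by
    simpa using hg.force_smul 0 x' (0 : E d)
  refine Prod.ext ?_ (Prod.ext ?_ (Prod.ext ?_ ?_))
  · simp [hamField_fst]
  · simp [hg.hamField_snd, hforce]
  · simp [hamField, ham]
  · simp [hamField, ham]

theorem IsMetric.zero_mem_unitMomenta (hg : IsMetric g) (hb : 0 < b) (hc : 0 < c) :
    (0 : E d × E d × E d) ∈ unitMomenta g b c x₀ := by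
  refine ⟨by simpa using hb, by simpa using hc, by simpa using hc, fun _ => (x₀, 0, 0, 0), rfl, ?_⟩
  intro s _
  rw [hg.hamField_rest]
  exact hasDerivWithinAt_const _ _ _

theorem IsMetric.sqrt_abs_jac (hg : IsMetric g) (ht : 0 < t)
    (hγ : IsCharacteristic g t x₀ y₀ ζ γ) :
    √|jac g t x₀ y₀ ζ| = t ^ (2 * d) * √|unitJac g x₀ (t • y₀, dilMom t ζ)| := by
  have hpow : t ^ (4 * d) = (t ^ (2 * d)) ^ 2 := by ring
  rw [hg.jac_dil ht hγ, abs_mul, Real.sqrt_mul (abs_nonneg _), abs_of_pos (pow_pos ht _), hpow,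
    Real.sqrt_sq (pow_pos ht _).le, unitJac]

theorem IsMetric.continuousAt_sqrt_abs_unitJac_dil (hg : IsMetric g)
    (hs : (s • y₀, dilMom s ζ) ∈ unitMomenta g b c x₀) :
    ContinuousAt (fun s => √|unitJac g x₀ (s • y₀, dilMom s ζ)|) s := by
  have hdil : Continuous fun s : ℝ => (s • y₀, dilMom s ζ) := by
    simp only [dilMom_apply]
    fun_prop
  exact (ContinuousAt.comp (g := unitJac g x₀) (f := fun s : ℝ => (s • y₀, dilMom s ζ)) (x := s)
    (hg.contDiffAt_unitJac hs).continuousAt hdil.continuousAt).abs.sqrt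

theorem IsMetric.tendsto_sqrt_abs_unitJac_dil (hg : IsMetric g) (hb : 0 < b) (hc : 0 < c) :
    Filter.Tendsto (fun s => √|unitJac g x₀ (s • y₀, dilMom s ζ)|) (𝓝[>] 0)
      (𝓝 √|unitJac g x₀ 0|) := by
  have hzero : ((0 : ℝ) • y₀, dilMom 0 ζ) = 0 := by simp [dilMom_apply, Prod.zero_eq_mk]
  have hcont := hg.continuousAt_sqrt_abs_unitJac_dil (s := 0) (x₀ := x₀) (y₀ := y₀) (ζ := ζ)
    (by rw [hzero]; exact hg.zero_mem_unitMomenta hb hc)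
  simpa only [hzero] using hcont.tendsto.mono_left (nhdsWithin_le_nhds (s := Set.Ioi 0))

theorem IsCharacteristic.continuousOn_base (hγ : IsCharacteristic g t x₀ y₀ ζ γ) :
    ContinuousOn (fun s => (s, (γ s).1, (γ s).2.1)) (Set.Icc 0 t) :=
  continuousOn_id.prodMk
    (hγ.isIntegralCurveOn.continuousOn.fst.prodMk hγ.isIntegralCurveOn.continuousOn.snd.fst)

theorem IsMetric.tendsto_base (hg : IsMetric g) (ht : t ∈ Set.Ioo 0 T)
    (hζ : ζ ∈ momenta g c t x₀ y₀) (hγ : IsCharacteristic g t x₀ y₀ ζ γ) :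
    Filter.Tendsto (fun s => (s, (γ s).1, (γ s).2.1)) (𝓝[>] 0)
      (𝓝[reached g T c x₀ y₀] (0, x₀, y₀)) := by
  refine tendsto_nhdsWithin_iff.2 ⟨?_, ?_⟩
  · have hcont := (hγ.continuousOn_base 0 ⟨le_rfl, ht.1.le⟩).tendsto
    rw [hγ.init] at hcont
    exact hcont.mono_left <| nhdsWithin_le_of_mem <|
      Filter.mem_of_superset (Ioo_mem_nhdsGT ht.1) Set.Ioo_subset_Icc_self
  · filter_upwards [Ioo_mem_nhdsGT ht.1] with s hs
    exact hg.mem_reached ⟨hs.1, hs.2.trans ht.2⟩ (momenta_anti hs.1.le hs.2.le hζ)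
      (hγ.mono hs.2.le)

namespace UniquelySolvable

theorem continuousOn_amplitude (h : UniquelySolvable g T b c r x₀) (hg : IsMetric g)
    (hb : ∀ t ∈ Set.Ioo 0 T, ENNReal.ofReal (t * ‖y₀‖) < b)
    (hφ : IsAmplitude g T c x₀ y₀ S φ κ) (ht : t ∈ Set.Ioo 0 T) (hζ : ζ ∈ momenta g c t x₀ y₀)
    (hγ : IsCharacteristic g t x₀ y₀ ζ γ) :
    ContinuousOn (fun s => φ s (γ s).1 (γ s).2.1) (Set.Ioc 0 t) := fun s hs =>
  ContinuousAt.comp_continuousWithinAt (g := packed φ) (f := fun s => (s, (γ s).1, (γ s).2.1))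
    (h.contDiffAt_of_contDiffOn_reached hg hb hφ.contDiffOn (hg.mem_reached
      ⟨hs.1, hs.2.trans_lt ht.2⟩ (momenta_anti hs.1.le hs.2 hζ) (hγ.mono hs.2))).continuousAt
    ((hγ.continuousOn_base s ⟨hs.1.le, hs.2⟩).mono Set.Ioc_subset_Icc_self)

theorem amplitude_mul_sqrt_unitJac_eq (h : UniquelySolvable g T b c r x₀) (hg : IsMetric g)
    (hb : ∀ t ∈ Set.Ioo 0 T, ENNReal.ofReal (t * ‖y₀‖) < b) (hS : IsPhase g T c x₀ y₀ S)
    (hφ : IsAmplitude g T c x₀ y₀ S φ κ) (ht : t ∈ Set.Ioo 0 T) (hζ : ζ ∈ momenta g c t x₀ y₀)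
    (hγ : IsCharacteristic g t x₀ y₀ ζ γ) :
    t ^ (2 * d) * φ t (γ t).1 (γ t).2.1 * √|unitJac g x₀ (t • y₀, dilMom t ζ)| =
      κ * √|unitJac g x₀ 0| := by
  set j : ℝ → ℝ := fun s => √|unitJac g x₀ (s • y₀, dilMom s ζ)|
  set v : ℝ → ℝ := fun s => s ^ (2 * d) * φ s (γ s).1 (γ s).2.1 * j s
  have hv : ContinuousOn v (Set.Ioc 0 t) :=
    ((continuousOn_id.pow _).mul (h.continuousOn_amplitude hg hb hφ ht hζ hγ)).mul fun s hs =>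
      (hg.continuousAt_sqrt_abs_unitJac_dil ((hg.dil_mem_unitMomenta_iff hs.1).2
        ⟨hb s ⟨hs.1, hs.2.trans_lt ht.2⟩, momenta_anti hs.1.le hs.2 hζ⟩)).continuousWithinAt
  have hv' : ∀ s ∈ Set.Ioo 0 t, HasDerivAt v 0 s := fun s hs => by
    refine (h.hasDerivAt_amplitude_mul_sqrt_jac hg hb hS hφ ht hζ hγ hs).congr_of_eventuallyEq ?_
    filter_upwards [Ioo_mem_nhds hs.1 hs.2] with u hu
    rw [hg.sqrt_abs_jac hu.1 (hγ.mono hu.2.le)]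
    ring
  have hv₀ : Filter.Tendsto v (𝓝[>] 0) (𝓝 (κ * √|unitJac g x₀ 0|)) :=
    (hφ.tendsto.comp (hg.tendsto_base ht hζ hγ)).mul
      (hg.tendsto_sqrt_abs_unitJac_dil (zero_le.trans_lt (hb t ht)) (zero_le.trans_lt hζ.1))
  exact eq_of_tendsto_of_hasDerivAt_zero (f := v) ht.1 hv hv' hv₀

end UniquelySolvable

/-- The profile `|J|^{-1/2}` of the amplitude, as a function of the starting point and the end
point `(y₀, x, y)` at time `1`. -/
def profile (g : E d → E d →L[ℝ] E d) (b c : ℝ≥0∞) (x₀ : E d) (o : E d × E d × E d) : ℝ :=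
  (√|unitJac g x₀ (unitInverse g b c x₀ o)|)⁻¹

namespace UniquelySolvable

theorem profile_pos (h : UniquelySolvable g T b c r x₀) (hg : IsMetric g) (hT : 0 < T)
    {o : E d × E d × E d} (ho : o ∈ unitReached g b c x₀) : 0 < profile g b c x₀ o :=
  inv_pos.2 (Real.sqrt_pos.2 (abs_pos.2 (h.unitJac_ne_zero hg hT (unitInverse_mem ho))))

theorem contDiffAt_profile (h : UniquelySolvable g T b c r x₀) (hg : IsMetric g) (hT : 0 < T)
    {o : E d × E d × E d} (ho : o ∈ unitReached g b c x₀) :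
    ContDiffAt ℝ ∞ (profile g b c x₀) o := by
  have hJ := h.unitJac_ne_zero hg hT (unitInverse_mem ho)
  have hsmooth : ContDiffAt ℝ ∞ (fun o => unitJac g x₀ (unitInverse g b c x₀ o)) o :=
    ContDiffAt.comp o (g := unitJac g x₀) (hg.contDiffAt_unitJac (unitInverse_mem ho))
      (h.contDiffAt_unitInverse hg hT ho)
  exact ((hsmooth.abs hJ).sqrt (abs_pos.2 hJ).ne').inv (Real.sqrt_pos.2 (abs_pos.2 hJ)).ne'

theorem amplitude_eq_profile (h : UniquelySolvable g T b c r x₀) (hg : IsMetric g)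
    (hb : ∀ t ∈ Set.Ioo 0 T, ENNReal.ofReal (t * ‖y₀‖) < b) (hS : IsPhase g T c x₀ y₀ S)
    (hφ : IsAmplitude g T c x₀ y₀ S φ κ) {x y : E d} (hz : (t, x, y) ∈ reached g T c x₀ y₀) :
    φ t x y = κ * √|unitJac g x₀ 0| / t ^ (2 * d) * profile g b c x₀ (t • y₀, x, t • y) := by
  obtain ⟨ht : t ∈ Set.Ioo 0 T, ζ, hζ, hend : endpoint g t x₀ y₀ ζ = (x, y)⟩ := hz
  obtain ⟨γ, hγ⟩ := hζ.2.2
  have hT : 0 < T := ht.1.trans ht.2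
  have hmem := (hg.dil_mem_unitMomenta_iff ht.1).2 ⟨hb t ht, hζ⟩
  obtain ⟨rfl, rfl⟩ := Prod.mk.inj ((hg.endpoint_eq ht.1.le hγ).symm.trans hend)
  have hdil := hg.unitEndpoint_dil (x₀ := x₀) (y₀ := y₀) (ζ := ζ) ht.1
  rw [hend] at hdil
  rw [← hdil, profile, h.unitInverse_unitEndpoint hg hT hmem,
    ← h.amplitude_mul_sqrt_unitJac_eq hg hb hS hφ ht hζ hγ]
  have hJ := (Real.sqrt_pos.2 (abs_pos.2 (h.unitJac_ne_zero hg hT hmem))).ne'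
  have hpow := (pow_pos ht.1 (2 * d)).ne'
  field_simp

end UniquelySolvable

end AmplitudeFormula

/-! ### The parabolic operator applied to the ansatz -/

section Ansatz

variable {d : ℕ} {g : E d → E d →L[ℝ] E d} {S φ u : ℝ → E d → E d → ℝ} {C : ℝ → ℝ} {h t : ℝ}
  {x y : E d}

theorem trace_comp_smulRight_innerSL (A : E d →L[ℝ] E d) (a v : E d) :
    LinearMap.trace ℝ (E d) ((A ∘L (innerSL ℝ a).smulRight v : E d →L[ℝ] E d) : E d →ₗ[ℝ] E d) =
      ⟪a, A v⟫_ℝ := by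
  have hcomp : ((A ∘L (innerSL ℝ a).smulRight v : E d →L[ℝ] E d) : E d →ₗ[ℝ] E d) =
      (innerSL ℝ a : E d →ₗ[ℝ] ℝ).smulRight (A v) := by
    ext1 w
    exact map_smul A _ v
  rw [hcomp, LinearMap.trace_smulRight]
  rfl

theorem hasFDerivAt_fibre (hu : DifferentiableAt ℝ (packed u) (t, x, y)) :
    HasFDerivAt (fun y' => u t x y') (innerSL ℝ (gradY u t x y)) y :=
  (HasFDerivAt.comp y (g := fun w : E d × E d => u t w.1 w.2) (hasFDerivAt_space hu)
    (hasFDerivAt_prodMk_right x y)).congr_fderiv (ContinuousLinearMap.coprod_comp_inr _ _)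

theorem hasFDerivAt_prefactor {F : Type*} [NormedAddCommGroup F] [NormedSpace ℝ F] {f : F → ℝ}
    {f' : F →L[ℝ] ℝ} {z : F} (hf : HasFDerivAt f f' z) (k h : ℝ) :
    HasFDerivAt (fun z => k * Real.exp (-f z / h)) (-(k * Real.exp (-f z / h) / h) • f') z := by
  have hexp := (hf.neg.mul_const h⁻¹).exp.const_mul k
  simp only [← div_eq_mul_inv, Pi.neg_apply] at hexp
  refine hexp.congr_fderiv ?_
  module

theorem hasFDerivAt_packed_ansatz {z : ℝ × E d × E d} (hS : DifferentiableAt ℝ (packed S) z)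
    (hφ : DifferentiableAt ℝ (packed φ) z) :
    HasFDerivAt (packed (ansatz C S φ h))
      ((C h * Real.exp (-(packed S z) / h)) •
        (fderiv ℝ (packed φ) z - (packed φ z / h) • fderiv ℝ (packed S) z)) z := by
  have hmul := (hasFDerivAt_prefactor hS.hasFDerivAt (C h) h).mul hφ.hasFDerivAt
  refine (hmul.congr_of_eventuallyEq (.of_forall fun z => ?_)).congr_fderiv ?_
  · exact mul_right_comm _ _ _
  · module

theorem gradX_ansatz (hS : DifferentiableAt ℝ (packed S) (t, x, y))
    (hφ : DifferentiableAt ℝ (packed φ) (t, x, y)) :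
    gradX (ansatz C S φ h) t x y = (C h * Real.exp (-(S t x y) / h)) •
      (gradX φ t x y - (φ t x y / h) • gradX S t x y) := by
  have hu := hasFDerivAt_packed_ansatz (C := C) (h := h) hS hφ
  refine ext_inner_right ℝ fun v => ?_
  rw [inner_gradX hu.differentiableAt, hu.fderiv, inner_smul_left, inner_sub_left, inner_smul_left,
    inner_gradX hS, inner_gradX hφ]
  rfl

theorem gradY_ansatz (hS : DifferentiableAt ℝ (packed S) (t, x, y))
    (hφ : DifferentiableAt ℝ (packed φ) (t, x, y)) :
    gradY (ansatz C S φ h) t x y = (C h * Real.exp (-(S t x y) / h)) •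
      (gradY φ t x y - (φ t x y / h) • gradY S t x y) := by
  have hu := hasFDerivAt_packed_ansatz (C := C) (h := h) hS hφ
  refine ext_inner_right ℝ fun v => ?_
  rw [inner_gradY hu.differentiableAt, hu.fderiv, inner_smul_left, inner_sub_left, inner_smul_left,
    inner_gradY hS, inner_gradY hφ]
  rfl

theorem derivT_ansatz (hS : DifferentiableAt ℝ (packed S) (t, x, y))
    (hφ : DifferentiableAt ℝ (packed φ) (t, x, y)) :
    derivT (ansatz C S φ h) t x y = C h * Real.exp (-(S t x y) / h) *
      (derivT φ t x y - φ t x y / h * derivT S t x y) := by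
  have hu := hasFDerivAt_packed_ansatz (C := C) (h := h) hS hφ
  rw [derivT_eq hu.differentiableAt, hu.fderiv, derivT_eq hS, derivT_eq hφ]
  rfl

theorem hasFDerivAt_gradY_ansatz (hS : ContDiffAt ℝ 2 (packed S) (t, x, y))
    (hφ : ContDiffAt ℝ 2 (packed φ) (t, x, y)) :
    HasFDerivAt (fun y' => gradY (ansatz C S φ h) t x y')
      ((C h * Real.exp (-(S t x y) / h)) •
        (fderiv ℝ (fun y' => gradY φ t x y') y
          - (φ t x y / h) • fderiv ℝ (fun y' => gradY S t x y') y
          - h⁻¹ • ((innerSL ℝ (gradY φ t x y)).smulRight (gradY S t x y)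
            + (innerSL ℝ (gradY S t x y)).smulRight (gradY φ t x y)
            - (φ t x y / h) • (innerSL ℝ (gradY S t x y)).smulRight (gradY S t x y)))) y := by
  have hpoint : ContinuousAt (fun y : E d => (t, x, y)) y := by fun_prop
  have hgrad : (fun y' => gradY (ansatz C S φ h) t x y') =ᶠ[𝓝 y] fun y' =>
      (C h * Real.exp (-(S t x y') / h)) •
        (gradY φ t x y' - (φ t x y' / h) • gradY S t x y') := by
    filter_upwards [hpoint.eventually (hS.eventually (by simp)),
      hpoint.eventually (hφ.eventually (by simp))] with y' hSy' hφy'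
    exact gradY_ansatz (hSy'.differentiableAt (by simp)) (hφy'.differentiableAt (by simp))
  have hprefactor := hasFDerivAt_prefactor
    (hasFDerivAt_fibre (hS.differentiableAt (by simp))) (C h) h
  have hφh : HasFDerivAt (fun y' => φ t x y' / h) (h⁻¹ • innerSL ℝ (gradY φ t x y)) y := by
    simpa only [div_eq_mul_inv] using
      (hasFDerivAt_fibre (hφ.differentiableAt (by simp))).mul_const h⁻¹
  refine ((hprefactor.smul ((hasFDerivAt_gradY_fibre hφ).sub
    (hφh.smul (hasFDerivAt_gradY_fibre hS)))).congr_of_eventuallyEq hgrad).congr_fderiv ?_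
  ext1 v
  simp only [add_apply, sub_apply, smul_apply, ContinuousLinearMap.smulRight_apply, smul_eq_mul,
    Pi.sub_apply, Pi.smul_apply']
  module

theorem IsMetric.trHessY_ansatz (hg : IsMetric g) (hS : ContDiffAt ℝ 2 (packed S) (t, x, y))
    (hφ : ContDiffAt ℝ 2 (packed φ) (t, x, y)) :
    trHessY g (ansatz C S φ h) t x y = C h * Real.exp (-(S t x y) / h) *
      (trHessY g φ t x y - φ t x y / h * trHessY g S t x y
        - 2 / h * ⟪g x (gradY S t x y), gradY φ t x y⟫_ℝ
        + φ t x y / h ^ 2 * ⟪g x (gradY S t x y), gradY S t x y⟫_ℝ) := by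
  rw [trHessY, (hasFDerivAt_gradY_ansatz hS hφ).fderiv]
  simp only [ContinuousLinearMap.comp_smul, ContinuousLinearMap.comp_sub,
    ContinuousLinearMap.comp_add, ContinuousLinearMap.toLinearMap_sub,
    ContinuousLinearMap.toLinearMap_add, ContinuousLinearMap.toLinearMap_smul, map_sub, map_add,
    map_smul, trace_comp_smulRight_innerSL, smul_eq_mul]
  rw [real_inner_comm (g x (gradY S t x y)) (gradY φ t x y),
    real_inner_comm (g x (gradY S t x y)) (gradY S t x y),
    ← hg.symm x (gradY S t x y) (gradY φ t x y), trHessY, trHessY]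
  ring

theorem IsMetric.parabolicOp_ansatz (hg : IsMetric g) (hh : h ≠ 0)
    (hS : ContDiffAt ℝ 2 (packed S) (t, x, y)) (hφ : ContDiffAt ℝ 2 (packed φ) (t, x, y))
    (hHJ : derivT S t x y + ham g x y (gradX S t x y) (gradY S t x y) = 0)
    (htransport : derivT φ t x y + ⟪g x (gradY S t x y), gradY φ t x y⟫_ℝ
      + (1 / 2) * φ t x y * trHessY g S t x y
      - ⟪coG g x y, gradX φ t x y⟫_ℝ + (1 / 2) * ⟪force g x y, gradY φ t x y⟫_ℝ = 0) :
    parabolicOp g h (ansatz C S φ h) t x y =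
      -(h ^ 2 / 2) * C h * (trHessY g φ t x y * Real.exp (-(S t x y) / h)) := by
  have hS' := hS.differentiableAt (by simp)
  have hφ' := hφ.differentiableAt (by simp)
  rw [parabolicOp, hamOp, hg.trHessY_ansatz hS hφ, derivT_ansatz hS' hφ', gradX_ansatz hS' hφ',
    gradY_ansatz hS' hφ']
  simp only [inner_smul_right, inner_sub_right]
  rw [ham] at hHJ
  field_simp
  linear_combination 2 * C h * h * htransport - 2 * C h * φ t x y * hHJ

end Ansatz

/-! ### The multiplicative error bound -/

section FibreHessian

variable {d : ℕ} {g : E d → E d →L[ℝ] E d} {f : E d × E d × E d → ℝ} {o : E d × E d × E d}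

/-- The gradient of a function of `(y₀, x, y)` in the fibre variable `y`. -/
def fibreGrad (f : E d × E d × E d → ℝ) (o : E d × E d × E d) : E d :=
  gradient (fun η => f (o.1, o.2.1, η)) o.2.2

/-- The trace of `g(x)` times the Hessian of a function of `(y₀, x, y)` in the fibre variable
`y`. -/
def fibreTrHess (g : E d → E d →L[ℝ] E d) (f : E d × E d × E d → ℝ) (o : E d × E d × E d) : ℝ :=
  LinearMap.trace ℝ (E d) ((g o.2.1 ∘L
    fderiv ℝ (fun η => fibreGrad f (o.1, o.2.1, η)) o.2.2 : E d →L[ℝ] E d) : E d →ₗ[ℝ] E d)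

/-- The inclusion `η ↦ (0, 0, η)` of the fibre direction. -/
def fibreIncl : E d →L[ℝ] E d × E d × E d :=
  (ContinuousLinearMap.inr ℝ (E d) (E d × E d)).comp (ContinuousLinearMap.inr ℝ (E d) (E d))

theorem hasFDerivAt_fibreIncl (o : E d × E d × E d) :
    HasFDerivAt (fun η : E d => (o.1, o.2.1, η)) fibreIncl o.2.2 :=
  HasFDerivAt.comp o.2.2 (g := fun w => (o.1, w)) (hasFDerivAt_prodMk_right o.1 o.2)
    (hasFDerivAt_prodMk_right o.2.1 o.2.2)

theorem inner_fibreGrad (hf : DifferentiableAt ℝ f o) (v : E d) :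
    ⟪fibreGrad f o, v⟫_ℝ = fderiv ℝ f o (fibreIncl v) :=
  inner_gradient_comp (f := f) (j := fun η => (o.1, o.2.1, η)) hf (hasFDerivAt_fibreIncl o) v

theorem contDiffAt_fibreGrad (hf : ContDiffAt ℝ 2 f o) : ContDiffAt ℝ 1 (fibreGrad f) o := by
  refine contDiffAt_of_inner fun v => ?_
  have hpartial : ContDiffAt ℝ 1 (fun o => fderiv ℝ f o (fibreIncl v)) o :=
    (hf.fderiv_right (m := 1) (by norm_num)).clm_apply contDiffAt_const
  refine hpartial.congr_of_eventuallyEq ?_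
  filter_upwards [hf.eventually (by simp)] with o' ho'
  exact inner_fibreGrad (ho'.differentiableAt (by simp)) v

theorem hasFDerivAt_fibreGrad (hf : ContDiffAt ℝ 2 f o) :
    HasFDerivAt (fun η => fibreGrad f (o.1, o.2.1, η))
      ((fderiv ℝ (fibreGrad f) o).comp fibreIncl) o.2.2 :=
  HasFDerivAt.comp o.2.2 (g := fibreGrad f)
    ((contDiffAt_fibreGrad hf).differentiableAt (by simp)).hasFDerivAt (hasFDerivAt_fibreIncl o)

theorem continuousAt_fibreTrHess (hg : Continuous g) (hf : ContDiffAt ℝ 2 f o) :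
    ContinuousAt (fibreTrHess g f) o := by
  let tr : (E d →L[ℝ] E d) →ₗ[ℝ] ℝ := LinearMap.trace ℝ (E d) ∘ₗ ContinuousLinearMap.coeLM ℝ
  have htr : Continuous tr := tr.continuous_of_finiteDimensional
  have hgo : ContinuousAt (fun o : E d × E d × E d => g o.2.1) o :=
    (hg.comp continuous_snd.fst).continuousAt
  have hHess : ContinuousAt (fderiv ℝ (fibreGrad f)) o :=
    ((contDiffAt_fibreGrad hf).fderiv_right (m := 0) (by simp)).continuousAt
  have hop : ContinuousAt
      (fun o => tr ((g o.2.1).comp ((fderiv ℝ (fibreGrad f) o).comp fibreIncl))) o :=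
    htr.continuousAt.comp (hgo.clm_comp (hHess.clm_comp continuousAt_const))
  refine hop.congr ?_
  filter_upwards [hf.eventually (by simp)] with o' ho'
  rw [fibreTrHess, (hasFDerivAt_fibreGrad ho').fderiv]
  rfl

variable {φ : ℝ → E d → E d → ℝ} {η₀ x y : E d} {k t : ℝ}

theorem gradY_eq_smul_fibreGrad (hf : DifferentiableAt ℝ f (η₀, x, t • y))
    (hφ : ∀ᶠ y' in 𝓝 y, φ t x y' = k * f (η₀, x, t • y')) :
    gradY φ t x y = (k * t) • fibreGrad f (η₀, x, t • y) := by
  have hj : HasFDerivAt (fun y : E d => (η₀, x, t • y))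
      (fibreIncl.comp (t • ContinuousLinearMap.id ℝ (E d))) y :=
    HasFDerivAt.comp y (g := fun η : E d => (η₀, x, η)) (hasFDerivAt_fibreIncl (η₀, x, t • y))
      ((hasFDerivAt_id y).const_smul t)
  have hfj := (HasFDerivAt.comp y (g := f) hf.hasFDerivAt hj).const_mul k
  refine ext_inner_right ℝ fun v => ?_
  rw [gradY, inner_gradient_left, (hfj.congr_of_eventuallyEq hφ).fderiv, inner_smul_left,
    inner_fibreGrad hf]
  simp only [smul_apply, ContinuousLinearMap.comp_apply, ContinuousLinearMap.id_apply, map_smul,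
    smul_eq_mul, conj_trivial, mul_assoc]

theorem trHessY_eq_mul_fibreTrHess (hf : ContDiffAt ℝ 2 f (η₀, x, t • y))
    (hφ : ∀ᶠ y' in 𝓝 y, φ t x y' = k * f (η₀, x, t • y')) :
    trHessY g φ t x y = k * t ^ 2 * fibreTrHess g f (η₀, x, t • y) := by
  have hpoint : ContinuousAt (fun y' : E d => (η₀, x, t • y')) y := by fun_prop
  have hgrad : (fun y' => gradY φ t x y') =ᶠ[𝓝 y]
      fun y' => (k * t) • fibreGrad f (η₀, x, t • y') := by
    filter_upwards [hφ.eventually_nhds, hpoint.eventually (hf.eventually (by simp))]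
      with y' hφy' hfy'
    exact gradY_eq_smul_fibreGrad (hfy'.differentiableAt (by simp)) hφy'
  have hfibre := hasFDerivAt_fibreGrad hf
  have hcomp := (HasFDerivAt.comp y (g := fun η => fibreGrad f (η₀, x, η)) hfibre
    ((hasFDerivAt_id y).const_smul t)).const_smul (k * t)
  rw [trHessY, (hcomp.congr_of_eventuallyEq hgrad).fderiv, fibreTrHess, hfibre.fderiv]
  simp only [ContinuousLinearMap.comp_smul, ContinuousLinearMap.comp_id,
    ContinuousLinearMap.toLinearMap_smul, map_smul, smul_eq_mul]
  ring

end FibreHessian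

section Bound

variable {d : ℕ} {g : E d → E d →L[ℝ] E d} {T t ρ β κ : ℝ} {b c r : ℝ≥0∞} {x₀ y₀ x y : E d}
  {S φ : ℝ → E d → E d → ℝ}

/-- The starting points and end points `(y₀, x, y)` at time `1` with `|y₀| ≤ β`, `|x - x₀| ≤ ρ` and
`|y - y₀| ≤ ρ`, on which the error bound is uniform. -/
def closedTube (x₀ : E d) (ρ β : ℝ) : Set (E d × E d × E d) :=
  {o | ‖o.1‖ ≤ β ∧ ‖o.2.1 - x₀‖ ≤ ρ ∧ ‖o.2.2 - o.1‖ ≤ ρ}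

theorem isCompact_closedTube (x₀ : E d) (ρ β : ℝ) : IsCompact (closedTube x₀ ρ β) := by
  have hclosed : IsClosed (closedTube x₀ ρ β) := by
    simp only [closedTube, Set.ofPred_and]
    exact (isClosed_le (by fun_prop) continuous_const).inter <|
      (isClosed_le (by fun_prop) continuous_const).inter
        (isClosed_le (by fun_prop) continuous_const)
  refine ((isCompact_closedBall (0 : E d) β).prod ((isCompact_closedBall x₀ ρ).prod
    (isCompact_closedBall (0 : E d) (ρ + β)))).of_isClosed_subset hclosed ?_
  rintro ⟨η₀, x, η⟩ ⟨hη₀ : ‖η₀‖ ≤ β, hx : ‖x - x₀‖ ≤ ρ, hη : ‖η - η₀‖ ≤ ρ⟩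
  refine ⟨mem_closedBall_zero_iff.2 hη₀, mem_closedBall_iff_norm.2 hx,
    mem_closedBall_zero_iff.2 ?_⟩
  calc ‖η‖ = ‖(η - η₀) + η₀‖ := by rw [sub_add_cancel]
    _ ≤ ρ + β := (norm_add_le _ _).trans (add_le_add hη hη₀)

theorem smul_mem_closedTube (ht : 0 ≤ t) (hy₀ : t * ‖y₀‖ ≤ β) (hx : ‖x - x₀‖ ≤ ρ)
    (hy : t * ‖y - y₀‖ ≤ ρ) : (t • y₀, x, t • y) ∈ closedTube x₀ ρ β :=
  ⟨by rwa [norm_smul, Real.norm_of_nonneg ht], hx,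
    by rwa [← smul_sub, norm_smul, Real.norm_of_nonneg ht]⟩

theorem ofReal_mul_norm_lt (hy₀ : T * ‖y₀‖ ≤ β) (hβ : ENNReal.ofReal β < b) :
    ∀ t ∈ Set.Ioo 0 T, ENNReal.ofReal (t * ‖y₀‖) < b := fun _ ht =>
  (ENNReal.ofReal_le_ofReal
    ((mul_le_mul_of_nonneg_right ht.2.le (norm_nonneg _)).trans hy₀)).trans_lt hβ

namespace UniquelySolvable

theorem closedTube_subset_unitReached (h : UniquelySolvable g T b c r x₀) (hg : IsMetric g)
    (hT : 0 < T) (hρ : ENNReal.ofReal ρ < r) (hβ : ENNReal.ofReal β < b) :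
    closedTube x₀ ρ β ⊆ unitReached g b c x₀ := fun _ ⟨hη₀, hx, hη⟩ =>
  h.mem_unitReached hg hT ((ENNReal.ofReal_le_ofReal hη₀).trans_lt hβ)
    ((ENNReal.ofReal_le_ofReal hx).trans_lt hρ) ((ENNReal.ofReal_le_ofReal hη).trans_lt hρ)

theorem exists_fibreTrHess_profile_le (h : UniquelySolvable g T b c r x₀) (hg : IsMetric g)
    (hT : 0 < T) (hρ : ENNReal.ofReal ρ < r) (hβ : ENNReal.ofReal β < b) :
    ∃ K : ℝ, ∀ o ∈ closedTube x₀ ρ β,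
      |fibreTrHess g (profile g b c x₀) o| ≤ K * profile g b c x₀ o := by
  have hsub := h.closedTube_subset_unitReached hg hT hρ hβ
  have hcont : ContinuousOn
      (fun o => fibreTrHess g (profile g b c x₀) o / profile g b c x₀ o) (closedTube x₀ ρ β) :=
    fun o ho => by
      have hprofile := h.contDiffAt_profile hg hT (hsub ho)
      exact ((continuousAt_fibreTrHess hg.smooth.continuous (hprofile.of_le ENat.LEInfty.out)).div
        hprofile.continuousAt (h.profile_pos hg hT (hsub ho)).ne').continuousWithinAt
  obtain ⟨K, hK⟩ := (isCompact_closedTube x₀ ρ β).exists_bound_of_continuousOn hcont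
  refine ⟨K, fun o ho => ?_⟩
  have hpos := h.profile_pos hg hT (hsub ho)
  have hquot := hK o ho
  rwa [Real.norm_eq_abs, abs_div, abs_of_pos hpos, div_le_iff₀ hpos] at hquot

theorem trHessY_amplitude (h : UniquelySolvable g T b c r x₀) (hg : IsMetric g)
    (hb : ∀ t ∈ Set.Ioo 0 T, ENNReal.ofReal (t * ‖y₀‖) < b) (hS : IsPhase g T c x₀ y₀ S)
    (hφ : IsAmplitude g T c x₀ y₀ S φ κ) (hz : (t, x, y) ∈ reached g T c x₀ y₀) :
    trHessY g φ t x y = κ * √|unitJac g x₀ 0| / t ^ (2 * d) * t ^ 2 *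
      fibreTrHess g (profile g b c x₀) (t • y₀, x, t • y) := by
  have ht : t ∈ Set.Ioo 0 T := hz.1
  have hpoint : ContinuousAt (fun y' : E d => (t, x, y')) y := by fun_prop
  refine trHessY_eq_mul_fibreTrHess ((h.contDiffAt_profile hg (ht.1.trans ht.2)
    ((hg.mem_reached_iff ht (hb t ht)).1 hz)).of_le ENat.LEInfty.out) ?_
  filter_upwards [hpoint.eventually ((h.isOpen_reached hg hb).mem_nhds hz)] with y' hy'
  exact h.amplitude_eq_profile hg hb hS hφ hy'

/-- The factor `t²` comes from the dilation `y ↦ t y` in `amplitude_eq_profile`. -/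
theorem exists_trHessY_amplitude_le (h : UniquelySolvable g T b c r x₀) (hg : IsMetric g)
    (hρ : ENNReal.ofReal ρ < r) (hβ : ENNReal.ofReal β < b) :
    ∃ K : ℝ, ∀ y₀ : E d, T * ‖y₀‖ ≤ β → ∀ (S φ : ℝ → E d → E d → ℝ) (κ : ℝ),
      IsPhase g T c x₀ y₀ S → IsAmplitude g T c x₀ y₀ S φ κ →
      ∀ t ∈ Set.Ioo 0 T, ∀ x y : E d, ‖x - x₀‖ ≤ ρ → t * ‖y - y₀‖ ≤ ρ →
        (t, x, y) ∈ reached g T c x₀ y₀ ∧ |trHessY g φ t x y| ≤ K * t ^ 2 * |φ t x y| := by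
  rcases le_or_gt T 0 with hT | hT
  · exact ⟨0, fun _ _ _ _ _ _ _ t ht => absurd (ht.1.trans ht.2) hT.not_gt⟩
  obtain ⟨K, hK⟩ := h.exists_fibreTrHess_profile_le hg hT hρ hβ
  refine ⟨K, fun y₀ hy₀ S φ κ hS hφ t ht x y hx hy => ?_⟩
  have hb := ofReal_mul_norm_lt hy₀ hβ
  have ho := smul_mem_closedTube ht.1.le ((mul_le_mul_of_nonneg_right ht.2.le
    (norm_nonneg _)).trans hy₀) hx hy
  have ho' := h.closedTube_subset_unitReached hg hT hρ hβ ho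
  have hz : (t, x, y) ∈ reached g T c x₀ y₀ := (hg.mem_reached_iff ht (hb t ht)).2 ho'
  refine ⟨hz, ?_⟩
  rw [h.trHessY_amplitude hg hb hS hφ hz, h.amplitude_eq_profile hg hb hS hφ hz]
  set k := κ * √|unitJac g x₀ 0| / t ^ (2 * d)
  simp only [abs_mul, abs_of_pos (h.profile_pos hg hT ho'), abs_of_pos (pow_pos ht.1 2)]
  calc |k| * t ^ 2 * |fibreTrHess g (profile g b c x₀) (t • y₀, x, t • y)|
      ≤ |k| * t ^ 2 * (K * profile g b c x₀ (t • y₀, x, t • y)) := by gcongr; exact hK _ ho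
    _ = K * t ^ 2 * (|k| * profile g b c x₀ (t • y₀, x, t • y)) := by ring

end UniquelySolvable

end Bound

end WKB

end

theorem mainTheorem2 {d : ℕ} (g : WKB.E d → WKB.E d →L[ℝ] WKB.E d) (hg : WKB.IsMetric g)
    (T : ℝ) (b c r : ℝ≥0∞) (x₀ : WKB.E d) (hsolv : WKB.UniquelySolvable g T b c r x₀)
    (ρ β : ℝ) (hρ : ENNReal.ofReal ρ < r) (hβ : ENNReal.ofReal β < b) :
    ∃ K : ℝ, ∀ y₀ : WKB.E d, T * ‖y₀‖ ≤ β →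
      ∀ (S φ : ℝ → WKB.E d → WKB.E d → ℝ) (κ : ℝ) (C : ℝ → ℝ),
        ContDiffOn ℝ 2 (fun z : ℝ × WKB.E d × WKB.E d => S z.1 z.2.1 z.2.2)
          (WKB.reached g T c x₀ y₀) →
        ContDiffOn ℝ 2 (fun z : ℝ × WKB.E d × WKB.E d => φ z.1 z.2.1 z.2.2)
          (WKB.reached g T c x₀ y₀) →
        WKB.IsTwoPointFunction g T c x₀ y₀ S →
        WKB.HamiltonJacobi g (WKB.reached g T c x₀ y₀) S →
        WKB.Transport g (WKB.reached g T c x₀ y₀) S φ →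
        Filter.Tendsto
          (fun z : ℝ × WKB.E d × WKB.E d => z.1 ^ (2 * d) * φ z.1 z.2.1 z.2.2)
          (𝓝[WKB.reached g T c x₀ y₀] (0, x₀, y₀)) (𝓝 κ) →
        (∀ h > 0, ∀ t x y, (t, x, y) ∈ WKB.reached g T c x₀ y₀ →
          WKB.parabolicOp g h (WKB.ansatz C S φ h) t x y =
            -(h ^ 2 / 2) * C h * (WKB.trHessY g φ t x y * Real.exp (-(S t x y) / h))) ∧
        ∀ h > 0, ∀ t ∈ Set.Ioo 0 T, ∀ x y : WKB.E d, ‖x - x₀‖ ≤ ρ → t * ‖y - y₀‖ ≤ ρ →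
          |WKB.parabolicOp g h (WKB.ansatz C S φ h) t x y| ≤
            K * h ^ 2 * t ^ 2 * |WKB.ansatz C S φ h t x y| := by
  obtain ⟨K, hK⟩ := hsolv.exists_trHessY_amplitude_le hg hρ hβ
  refine ⟨K / 2, fun y₀ hy₀ S φ κ C hS hφ hS₂ hHJ htransport hκ => ?_⟩
  have hb := WKB.ofReal_mul_norm_lt hy₀ hβ
  have hremainder : ∀ h > 0, ∀ t x y, (t, x, y) ∈ WKB.reached g T c x₀ y₀ →
      WKB.parabolicOp g h (WKB.ansatz C S φ h) t x y =
        -(h ^ 2 / 2) * C h * (WKB.trHessY g φ t x y * Real.exp (-(S t x y) / h)) :=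
    fun h hh t x y hz => hg.parabolicOp_ansatz hh.ne'
      (hsolv.contDiffAt_of_contDiffOn_reached hg hb hS hz)
      (hsolv.contDiffAt_of_contDiffOn_reached hg hb hφ hz) (hHJ t x y hz) (htransport t x y hz)
  refine ⟨hremainder, fun h hh t ht x y hx hy => ?_⟩
  obtain ⟨hz, hbound⟩ :=
    hK y₀ hy₀ S φ κ ⟨hS, hS₂⟩ ⟨hφ, htransport, hκ⟩ t ht x y hx hy
  rw [hremainder h hh t x y hz, WKB.ansatz]
  simp only [abs_mul, abs_neg, abs_of_pos (half_pos (pow_pos hh 2)), Real.abs_exp]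
  calc h ^ 2 / 2 * |C h| * (|WKB.trHessY g φ t x y| * Real.exp (-(S t x y) / h))
      ≤ h ^ 2 / 2 * |C h| * (K * t ^ 2 * |φ t x y| * Real.exp (-(S t x y) / h)) := by gcongr
    _ = K / 2 * h ^ 2 * t ^ 2 * (|C h| * |φ t x y| * Real.exp (-(S t x y) / h)) := by ring
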